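/- Let $m,k\ge 0$, $n=2(k+m+2)$, let $G=UT(n)$ be the group of real upper unitriangular $n\times n$ matrices and $\mathfrak g=ut(n)$ its Lie algebra of strictly upper triangular matrices. Identify $\mathfrak g^*$ with the strictly lower triangular matrices via $f(x)=\operatorname{tr}(fx)$, let $G$ act on $\mathfrak g^*$ by the coadjoint action $(\mathrm{Ad}^*_g f)(x)=f(g^{-1}xg)$, let $G^f$ be the stabilizer of $f$, and put $\mathrm{Ad}_G(G^f)=\{hyh^{-1}: h\in G,\ y\in G^f\}$. Partition rows and columns into eight consecutive blocks of sizes $(m,1,1,k,k,1,1,m)$ and write the general $g\in G$ as a block matrix $(C_{ij})_{1\le i,j\le 8}$. Let $f\in\mathfrak g^*$ be the matrix with block $\Lambda_1$ at place $(8,1)$, $\Lambda_2$ at $(5,4)$, numbers $\gamma_1$ at $(6,2)$, $\gamma_2$ at $(7,3)$, $\gamma_3$ at $(7,6)$, and all other blocks zero. Here $\Lambda_1$ ($m\times m$) and $\Lambda_2$ ($k\times k$) are real matrices with zeros outside the second diagonal (the one from the lower left to the upper right corner); all second-diagonal entries of $\Lambda_1$ are nonzero, all second-diagonal entries of $\Lambda_2$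 except possibly the one in the upper right corner are nonzero, $\gamma_1,\gamma_2\ne0$, and $\gamma_3\in\mathbb R$ is arbitrary. Let $\Phi=\{(2,3),(4,5),(6,7)\}$. For an entry $c$ of a block $C_{ij}$, $i<j$, let $\Phi(c)$ be the set of $(a,b)\in\Phi$ with $a>i$ and $b<j$; let $\Delta(c)$ be the minor of $g$ formed by the rows of the blocks $a$ and the columns of the blocks $b$, $(a,b)\in\Phi(c)$ (the empty minor is $1$); let $\tilde\Delta(c)$ be the minor obtained by adding the row and the column of $c$; and let $\tilde c=\pm\Delta(c)^{-1}\tilde\Delta(c)$, where $\pm$ is the cofactor sign of the entry $c$ in the minor $\tilde\Delta(c)$. Put $S=S_0\cup S_1\cup S_2$, where 1. $S_0$ is the set of entries above the diagonal of the blocks $C_{11},C_{44},C_{55},C_{88}$; 2. $S_1$ is the set of all $\tilde c$, where $c$ runs through all entries of the blocks $C_{12},C_{14},C_{16},C_{34},C_{36},C_{38},C_{56},C_{58},C_{78}$; 3. $S_2$ consists of the entries of $C_{23}C_{35}+C_{24}C_{45}$ and of $C_{45}C_{57}+C_{46}C_{67}$, and of the function $\gamma_1C_{23}-\gamma_2C_{67}$.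 Let $d(g)=C_{23}\cdot\det C_{45}\cdot C_{67}$, let $\mathbb R'[G]$ be the localization of the algebra $\mathbb R[G]$ of regular (polynomial) functions on $G$ at the powers of $d$, so that $S\subset\mathbb R'[G]$, and let $I'$ be the ideal of $\mathbb R'[G]$ generated by $S$. Let $\mathrm{Ann}\,I'$ be the set of all $g\in G$ with $d(g)\ne0$ at which every element of $I'$ vanishes. Then the closure of $\mathrm{Ann}\,I'$ in $G$ (for the usual topology of the Lie group $G$) coincides with the closure of $\mathrm{Ad}_G(G^f)$ in $G$. -/

import Mathlib

/-! ### The group `UT(n, ℝ)`, its Lie algebra and the coadjoint action -/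

/-- `UT(n, ℝ)`: real upper triangular matrices of size `n` with units on the diagonal. -/
def UT (n : ℕ) : Submonoid (Matrix (Fin n) (Fin n) ℝ) where
  carrier := {g | (∀ i, g i i = 1) ∧ ∀ i j, j < i → g i j = 0}
  one_mem' := ⟨fun i => Matrix.one_apply_eq i, fun _ _ h => Matrix.one_apply_ne (ne_of_gt h)⟩
  mul_mem' := by
    rintro a b ⟨ha, ha'⟩ ⟨hb, hb'⟩
    refine ⟨fun i => ?_, fun i j hij => ?_⟩
    · rw [Matrix.mul_apply, Finset.sum_eq_single i]
      · rw [ha, hb, one_mul]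
      · intro l _ hl
        rcases lt_or_gt_of_ne hl with h | h
        · rw [ha' i l h, zero_mul]
        · rw [hb' l i h, mul_zero]
      · simp
    · rw [Matrix.mul_apply]
      refine Finset.sum_eq_zero fun l _ => ?_
      rcases lt_or_ge l i with h | h
      · rw [ha' i l h, zero_mul]
      · rw [hb' l j (lt_of_lt_of_le hij h), mul_zero]

namespace UT

variable {n : ℕ}

theorem det_eq_one (g : UT n) : (g : Matrix (Fin n) (Fin n) ℝ).det = 1 := by
  rw [Matrix.det_of_isUpperTriangular (fun i j h => g.2.2 i j h)]
  exact Finset.prod_eq_one fun i _ => g.2.1 i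

theorem inv_mem (g : UT n) : (g : Matrix (Fin n) (Fin n) ℝ)⁻¹ ∈ UT n := by
  have hdet : IsUnit (g : Matrix (Fin n) (Fin n) ℝ).det := by rw [det_eq_one]; exact isUnit_one
  have : Invertible (g : Matrix (Fin n) (Fin n) ℝ) :=
    Matrix.invertibleOfIsUnitDet _ hdet
  have hT : Matrix.BlockTriangular (g : Matrix (Fin n) (Fin n) ℝ)⁻¹ id :=
    Matrix.blockTriangular_inv_of_blockTriangular (fun i j h => g.2.2 i j h)
  refine ⟨fun i => ?_, fun i j h => hT h⟩
  have h1 := congrFun (congrFun (Matrix.nonsing_inv_mul _ hdet) i) i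
  rw [Matrix.mul_apply, Finset.sum_eq_single i, g.2.1 i, mul_one, Matrix.one_apply_eq] at h1
  · exact h1
  · intro l _ hl
    rcases lt_or_gt_of_ne hl with h | h
    · rw [hT (show id l < id i from h), zero_mul]
    · rw [g.2.2 l i h, mul_zero]
  · simp

/-- The group structure: matrix multiplication and the matrix inverse. -/
noncomputable instance : Group (UT n) where
  inv g := ⟨(g : Matrix (Fin n) (Fin n) ℝ)⁻¹, inv_mem g⟩
  inv_mul_cancel g := Subtype.ext <| Matrix.nonsing_inv_mul _ <| by
    rw [det_eq_one]; exact isUnit_one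

end UT

/-- The Lie algebra `ut(n, ℝ)` of `UT(n, ℝ)`: upper triangular matrices with zero diagonal. -/
def ut (n : ℕ) : Submodule ℝ (Matrix (Fin n) (Fin n) ℝ) where
  carrier := {x | ∀ i j, j ≤ i → x i j = 0}
  zero_mem' := fun _ _ _ => rfl
  add_mem' := by
    intro a b ha hb i j h
    rw [Matrix.add_apply, ha i j h, hb i j h, add_zero]
  smul_mem' := by
    intro c a ha i j h
    rw [Matrix.smul_apply, ha i j h, smul_zero]

theorem ut_mul_left {n : ℕ} (g : UT n) {x : Matrix (Fin n) (Fin n) ℝ} (hx : x ∈ ut n) :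
    (g : Matrix (Fin n) (Fin n) ℝ) * x ∈ ut n := by
  intro i j hij
  rw [Matrix.mul_apply]
  refine Finset.sum_eq_zero fun l _ => ?_
  rcases lt_or_ge l i with h | h
  · rw [g.2.2 i l h, zero_mul]
  · rw [hx l j (hij.trans h), mul_zero]

theorem ut_mul_right {n : ℕ} (g : UT n) {x : Matrix (Fin n) (Fin n) ℝ} (hx : x ∈ ut n) :
    x * (g : Matrix (Fin n) (Fin n) ℝ) ∈ ut n := by
  intro i j hij
  rw [Matrix.mul_apply]
  refine Finset.sum_eq_zero fun l _ => ?_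
  rcases le_or_gt l i with h | h
  · rw [hx i l h, zero_mul]
  · rw [g.2.2 l j (lt_of_le_of_lt hij h), mul_zero]

/-- The adjoint action `x ↦ g x g⁻¹` of `UT(n)` on `ut(n)`. -/
noncomputable def adj {n : ℕ} (g : UT n) : ut n →ₗ[ℝ] ut n where
  toFun x := ⟨(g : Matrix (Fin n) (Fin n) ℝ) * x * ((g⁻¹ : UT n) : Matrix (Fin n) (Fin n) ℝ),
    ut_mul_right _ (ut_mul_left g x.2)⟩
  map_add' x y := Subtype.ext <| by simp [mul_add, add_mul]
  map_smul' c x := Subtype.ext <| by simp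

/-- The coadjoint action `(Ad*_g f)(x) = f (g⁻¹ x g)` of `UT(n)` on the dual of `ut(n)`. -/
noncomputable def coadj {n : ℕ} (g : UT n) (f : Module.Dual ℝ (ut n)) : Module.Dual ℝ (ut n) :=
  f.comp (adj g⁻¹)

/-- The stabilizer `G^f` of `f` under the coadjoint action. -/
def coadjStabilizer {n : ℕ} (f : Module.Dual ℝ (ut n)) : Set (UT n) :=
  {g | coadj g f = f}

/-- The union `Ad_G(A)` of all conjugates of the elements of `A`. -/
def conjugates {n : ℕ} (A : Set (UT n)) : Set (UT n) :=
  {x | ∃ h : UT n, ∃ y ∈ A, x = h * y * h⁻¹}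

/-- The linear functional `x ↦ tr (F x)` on `ut(n)` given by a matrix `F`. -/
noncomputable def traceDual {n : ℕ} (F : Matrix (Fin n) (Fin n) ℝ) : Module.Dual ℝ (ut n) :=
  ((Matrix.traceLinearMap (Fin n) ℝ ℝ).comp (LinearMap.mulLeft ℝ F)).comp (ut n).subtype

/-! ### Block partition -/

/-- The sizes `(m, 1, 1, k, k, 1, 1, m)` of the eight blocks. Blocks are numbered `0, …, 7` here:
block number `b` is the `(b+1)`-st block. -/
def blockSize (m k : ℕ) : Fin 8 → ℕ := ![m, 1, 1, k, k, 1, 1, m]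

/-- The number of rows lying before a block. -/
def blockStart (m k : ℕ) : Fin 8 → ℕ :=
  ![0, m, m + 1, m + 2, m + 2 + k, m + 2 + 2 * k, m + 3 + 2 * k, m + 4 + 2 * k]

/-- The matrix size `n = 2(k + m + 2)`. -/
abbrev matSize (m k : ℕ) : ℕ := 2 * (k + m + 2)

theorem blockStart_add_blockSize_le (m k : ℕ) (b : Fin 8) :
    blockStart m k b + blockSize m k b ≤ matSize m k := by
  fin_cases b <;> simp [blockStart, blockSize, matSize] <;> omega

/-- The row (or column) of the whole matrix that is number `i` in block `b`. -/
def pos (m k : ℕ) (b : Fin 8) (i : Fin (blockSize m k b)) : Fin (matSize m k) :=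
  ⟨blockStart m k b + i, lt_of_lt_of_le (Nat.add_lt_add_left i.2 _)
    (blockStart_add_blockSize_le m k b)⟩

theorem pos_lt_pos {m k : ℕ} {a b : Fin 8} (h : a < b) (i : Fin (blockSize m k a)) (j : Fin (blockSize m k b)) :
    pos m k a i < pos m k b j := by
  have key : blockStart m k a + blockSize m k a ≤ blockStart m k b := by
    revert h; clear i j
    fin_cases a <;> fin_cases b <;> simp [blockStart, blockSize] <;> omega
  have := i.2
  simp only [pos, Fin.mk_lt_mk]; omega

/-! ### The functional `f` -/

/-- The `s × s` matrix whose second diagonal is `l₁, …, l_s`, read from the lower left corner to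
the upper right one (`l₁ = l 0` lies in the first column, `l_s` in the last one), and whose other
entries are zero. -/
def antidiag {s : ℕ} (l : Fin s → ℝ) : Matrix (Fin s) (Fin s) ℝ :=
  Matrix.of fun i j => if (i : ℕ) + j + 1 = s then l j else 0

/-- The block matrix with the given blocks. -/
def ofBlocks (m k : ℕ) (M : ∀ a b : Fin 8, Matrix (Fin (blockSize m k a)) (Fin (blockSize m k b)) ℝ) :
    Matrix (Fin (matSize m k)) (Fin (matSize m k)) ℝ :=
  Matrix.of fun p q => ∑ a, ∑ b, ∑ i, ∑ j,
    if pos m k a i = p ∧ pos m k b j = q then M a b i j else 0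

/-- The lower triangular matrix with blocks `Λ₁` at place `(8,1)`, `Λ₂` at `(5,4)`, `γ₁` at `(6,2)`,
`γ₂` at `(7,3)`, `γ₃` at `(7,6)` (places counted from one) and all other blocks zero; here `Λ₁` and
`Λ₂` have the second diagonals `l₁` and `l₂`. -/
def fMatrix (m k : ℕ) (l₁ : Fin m → ℝ) (l₂ : Fin k → ℝ) (γ₁ γ₂ γ₃ : ℝ) :
    Matrix (Fin (matSize m k)) (Fin (matSize m k)) ℝ :=
  ofBlocks m k fun a b =>
    match a, b with
    | 7, 0 => antidiag l₁
    | 4, 3 => antidiag l₂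
    | 5, 1 => Matrix.of fun _ _ => γ₁
    | 6, 2 => Matrix.of fun _ _ => γ₂
    | 6, 5 => Matrix.of fun _ _ => γ₃
    | _, _ => 0

/-! ### Regular functions, the localization and the ideal -/

/-- The algebra `ℝ[UT(n)]` of regular functions: polynomials in the entries above the diagonal. -/
abbrev CoordRing (n : ℕ) : Type := MvPolynomial {p : Fin n × Fin n // p.1 < p.2} ℝ

/-- The value of a regular function at `g`. -/
noncomputable def evalAt {n : ℕ} (g : UT n) : CoordRing n →+* ℝ :=
  MvPolynomial.eval fun p => (g : Matrix (Fin n) (Fin n) ℝ) p.1.1 p.1.2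

/-- The general element of `UT(n)`, as a matrix of regular functions. -/
noncomputable def genMatrix (n : ℕ) : Matrix (Fin n) (Fin n) (CoordRing n) :=
  Matrix.of fun i j => if h : i < j then MvPolynomial.X ⟨(i, j), h⟩ else if i = j then 1 else 0

/-- The blocks `C_{ab}` of the general element. -/
noncomputable def blockC (m k : ℕ) (a b : Fin 8) :
    Matrix (Fin (blockSize m k a)) (Fin (blockSize m k b)) (CoordRing (matSize m k)) :=
  (genMatrix (matSize m k)).submatrix (pos m k a) (pos m k b)

/-- `det C₂₃`, that is the only entry of the `1 × 1` block `C₂₃`. -/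
noncomputable def det23 (m k : ℕ) : CoordRing (matSize m k) :=
  Matrix.det (n := Fin 1) (blockC m k 1 2)

/-- `det C₄₅`. -/
noncomputable def det45 (m k : ℕ) : CoordRing (matSize m k) :=
  Matrix.det (n := Fin k) (blockC m k 3 4)

/-- `det C₆₇`, that is the only entry of the `1 × 1` block `C₆₇`. -/
noncomputable def det67 (m k : ℕ) : CoordRing (matSize m k) :=
  Matrix.det (n := Fin 1) (blockC m k 5 6)

/-- The denominator `d = det C₂₃ · det C₄₅ · det C₆₇`. -/
noncomputable def denom (m k : ℕ) : CoordRing (matSize m k) :=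
  det23 m k * det45 m k * det67 m k

/-- The localization of `ℝ[UT(n)]` at the powers of `d`. -/
abbrev LocRing (m k : ℕ) : Type := Localization.Away (denom m k)

/-- The value of an element of the localization at a point `g` with `d(g) ≠ 0`. -/
noncomputable def evalLoc (m k : ℕ) (g : UT (matSize m k)) (hg : evalAt g (denom m k) ≠ 0) :
    LocRing m k →+* ℝ :=
  IsLocalization.Away.lift (denom m k) (isUnit_iff_ne_zero.mpr hg)

/-- The zero set of an ideal of the localization: the points `g` of `UT(n)` with `d(g) ≠ 0` at
which all elements of the ideal vanish. -/
def zeroSet (m k : ℕ) (I : Ideal (LocRing m k)) : Set (UT (matSize m k)) :=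
  {g | ∃ hg : evalAt g (denom m k) ≠ 0, ∀ φ ∈ I, evalLoc m k g hg φ = 0}

/-- `Φ = {(2,3), (4,5), (6,7)}` (blocks counted from one). -/
def Phi : Finset (Fin 8 × Fin 8) := {(1, 2), (3, 4), (5, 6)}

theorem blockSize_of_mem_Phi (m k : ℕ) {p : Fin 8 × Fin 8} (hp : p ∈ Phi) :
    blockSize m k p.1 = blockSize m k p.2 := by
  simp only [Phi, Finset.mem_insert, Finset.mem_singleton] at hp
  rcases hp with rfl | rfl | rfl <;> rfl

/-- Index set of the rows, and of the columns, of the minor `Δ(c)` of an entry `c` of the block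
`C_{ab}`: the rows of the blocks `p` and the columns of the blocks `q`, for all `(p, q) ∈ Φ` with
`p > a` and `q < b`. -/
abbrev MinorIndex (m k : ℕ) (a b : Fin 8) : Type :=
  Σ p : {p : Fin 8 × Fin 8 // p ∈ Phi ∧ a < p.1 ∧ p.2 < b}, Fin (blockSize m k p.1.1)

/-- The rows of `Δ(c)`. -/
def minorRow (m k : ℕ) (a b : Fin 8) (x : MinorIndex m k a b) : Fin (matSize m k) :=
  pos m k x.1.1.1 x.2

/-- The columns of `Δ(c)`. -/
def minorCol (m k : ℕ) (a b : Fin 8) (x : MinorIndex m k a b) : Fin (matSize m k) :=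
  pos m k x.1.1.2 (Fin.cast (blockSize_of_mem_Phi m k x.1.2.1) x.2)

/-- The minor `Δ(c)` of an entry `c` of the block `C_{ab}`. -/
noncomputable def Delta (m k : ℕ) (a b : Fin 8) : CoordRing (matSize m k) :=
  ((genMatrix (matSize m k)).submatrix (minorRow m k a b) (minorCol m k a b)).det

theorem isUnit_denom (m k : ℕ) : IsUnit (algebraMap (CoordRing (matSize m k)) (LocRing m k) (denom m k)) :=
  IsLocalization.Away.algebraMap_isUnit (denom m k)

theorem gen_lower {n : ℕ} {i j : Fin n} (h : j < i) : genMatrix n i j = 0 := by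
  simp [genMatrix, not_lt.mpr h.le, h.ne']

/-- The determinant of the block `C_p`, for `p ∈ Φ`. -/
noncomputable def bdet (m k : ℕ) (p : {p : Fin 8 × Fin 8 // p ∈ Phi}) : CoordRing (matSize m k) :=
  Matrix.det (Matrix.of fun i j : Fin (blockSize m k p.1.1) => genMatrix (matSize m k) (pos m k p.1.1 i) (pos m k p.1.2 (Fin.cast (blockSize_of_mem_Phi m k p.2) j)))

theorem bdet_dvd (m k : ℕ) (p : {p : Fin 8 × Fin 8 // p ∈ Phi}) : bdet m k p ∣ denom m k := by
  obtain ⟨p, hp⟩ := p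
  have hp' := hp
  simp only [Phi, Finset.mem_insert, Finset.mem_singleton] at hp'
  rcases hp' with rfl | rfl | rfl
  · exact Dvd.intro _ (mul_assoc _ _ _).symm
  · exact Dvd.dvd.mul_right (Dvd.intro_left (det23 m k) rfl) _
  · exact Dvd.intro_left (det23 m k * det45 m k) rfl

/-- `Δ(c)` is a unit in the localization. -/
theorem Delta_isUnit (m k : ℕ) (a b : Fin 8) : IsUnit (algebraMap (CoordRing (matSize m k)) (LocRing m k) (Delta m k a b)) := by
  have A : ∀ p ∈ Phi, ∀ q ∈ Phi, q.1 < p.1 → q.2 < p.1 := by decide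
  have B : ∀ p ∈ Phi, ∀ q ∈ Phi, q.1 = p.1 → q = p := by decide
  have hT : Matrix.BlockTriangular ((genMatrix (matSize m k)).submatrix (minorRow m k a b) (minorCol m k a b)) (fun x => x.1.1.1) := by
    rintro ⟨⟨p, hp, hp'⟩, i⟩ ⟨⟨q, hq, hq'⟩, j⟩ h
    apply gen_lower
    apply pos_lt_pos
    exact A p hp q hq h
  rw [Delta, hT.det_fintype, map_prod]
  rw [IsUnit.prod_univ_iff]
  intro c
  by_cases hc : ∃ p : {p : Fin 8 × Fin 8 // p ∈ Phi ∧ a < p.1 ∧ p.2 < b}, p.1.1 = c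
  · obtain ⟨p, rfl⟩ := hc
    have inj : ∀ q : {p : Fin 8 × Fin 8 // p ∈ Phi ∧ a < p.1 ∧ p.2 < b}, q.1.1 = p.1.1 → q = p := by
      intro q h
      apply Subtype.ext
      exact B p.1 p.2.1 q.1 q.2.1 h
    let f : Fin (blockSize m k p.1.1) → {x : MinorIndex m k a b // x.1.1.1 = p.1.1} := fun i => ⟨⟨p, i⟩, rfl⟩
    have hf : Function.Bijective f := by
      constructor
      · intro i j h; simpa [f] using h
      · rintro ⟨⟨q, i⟩, h⟩
        obtain rfl := inj q h
        exact ⟨i, rfl⟩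
    rw [← Matrix.det_submatrix_equiv_self (Equiv.ofBijective f hf)]
    exact isUnit_of_dvd_unit (map_dvd _ (bdet_dvd m k ⟨p.1, p.2.1⟩)) (isUnit_denom m k)
  · have : IsEmpty {x : MinorIndex m k a b // x.1.1.1 = c} := ⟨fun x => hc ⟨x.1.1, x.2⟩⟩
    rw [Matrix.det_isEmpty]; simp

/-- The signed bordered minor `± Δ̃(c)` of the entry `c` of `C_{ab}` at place `(i, j)`: the row and
the column of `c` are added to those of `Δ(c)`. The added row and the added column are both listed
first (index `none`), so that `c` stands in the upper left corner; listing them in their natural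
order instead multiplies the determinant by the sign of the entry `c` in the minor, so this
determinant is `Δ̃(c)` already multiplied by that sign. -/
noncomputable def signedDeltaTilde (m k : ℕ) (a b : Fin 8) (i : Fin (blockSize m k a))
    (j : Fin (blockSize m k b)) : CoordRing (matSize m k) :=
  ((genMatrix (matSize m k)).submatrix
    (fun x : Option (MinorIndex m k a b) => x.elim (pos m k a i) (minorRow m k a b))
    (fun x : Option (MinorIndex m k a b) => x.elim (pos m k b j) (minorCol m k a b))).det

/-- The rational function `c̃ = ± Δ(c)⁻¹ Δ̃(c)` of the entry `c` of `C_{ab}` at place `(i, j)`. The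
minor `Δ(c)` is a product of some of `det C₂₃`, `det C₄₅`, `det C₆₇`, hence a unit in the
localization (`Delta_isUnit`), and `Ring.inverse` is its inverse. -/
noncomputable def cTilde (m k : ℕ) (a b : Fin 8) (i : Fin (blockSize m k a))
    (j : Fin (blockSize m k b)) : LocRing m k :=
  Ring.inverse (algebraMap (CoordRing (matSize m k)) (LocRing m k) (Delta m k a b)) *
    algebraMap (CoordRing (matSize m k)) (LocRing m k) (signedDeltaTilde m k a b i j)

/-- The blocks `(1,2), (1,4), (1,6), (3,4), (3,6), (3,8), (5,6), (5,8), (7,8)` (counted from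
one). -/
def bulletBlocks : Finset (Fin 8 × Fin 8) :=
  {(0, 1), (0, 3), (0, 5), (2, 3), (2, 5), (2, 7), (4, 5), (4, 7), (6, 7)}

/-- `S₀`: the entries above the diagonal of the blocks `C₁₁, C₄₄, C₅₅, C₈₈`. -/
def S0 (m k : ℕ) : Set (LocRing m k) :=
  {φ | ∃ b ∈ ({0, 3, 4, 7} : Finset (Fin 8)), ∃ i j : Fin (blockSize m k b), i < j ∧
    φ = algebraMap (CoordRing (matSize m k)) (LocRing m k) (blockC m k b b i j)}

/-- `S₁`: the functions `c̃`, for all entries `c` of the distinguished blocks. -/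
def S1 (m k : ℕ) : Set (LocRing m k) :=
  {φ | ∃ p ∈ bulletBlocks, ∃ (i : Fin (blockSize m k p.1)) (j : Fin (blockSize m k p.2)),
    φ = cTilde m k p.1 p.2 i j}

/-- `S₂`: the entries of `C₂₃ C₃₅ + C₂₄ C₄₅` and of `C₄₅ C₅₇ + C₄₆ C₆₇`, and the function
`γ₁ C₂₃ - γ₂ C₆₇`. -/
def S2 (m k : ℕ) (γ₁ γ₂ : ℝ) : Set (LocRing m k) :=
  {φ | ∃ i j, φ = algebraMap (CoordRing (matSize m k)) (LocRing m k)
      ((blockC m k 1 2 * blockC m k 2 4 + blockC m k 1 3 * blockC m k 3 4) i j)} ∪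
  {φ | ∃ i j, φ = algebraMap (CoordRing (matSize m k)) (LocRing m k)
      ((blockC m k 3 4 * blockC m k 4 6 + blockC m k 3 5 * blockC m k 5 6) i j)} ∪
  {algebraMap (CoordRing (matSize m k)) (LocRing m k)
      (MvPolynomial.C γ₁ * det23 m k - MvPolynomial.C γ₂ * det67 m k)}

/-- The ideal `I'` of the localization generated by `S = S₀ ∪ S₁ ∪ S₂`. -/
noncomputable def idealI' (m k : ℕ) (γ₁ γ₂ : ℝ) : Ideal (LocRing m k) :=
  Ideal.span (S0 m k ∪ S1 m k ∪ S2 m k γ₁ γ₂)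

/-!
Consider the elements `N` of the group with unit diagonal blocks whose only nonzero blocks above the
diagonal are the numbers `C₂₃ = α`, `C₆₇ = β`, `C₂₆`, `C₂₇`, `C₃₇` and the blocks `C₄₅ = B`,
`C₁₈ = D`, where `γ₁ α = γ₂ β`.

Comparing the blocks of `(g - 1) f` and `f (g - 1)`, one finds that `G^f` consists of those `N` for
which `B` and `D` are antidiagonal. On the other hand, `Ann I'` is the set of all conjugates of
those `N` for which `α`, `β` and `det B` are nonzero. Indeed, the bordered minors of
`h (N - 1) h⁻¹` belonging to `S₁` vanish, since each of them is the determinant of a product through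
fewer rows than its size. Conversely, for `g` in `Ann I'` the invertible blocks `C₂₃`, `C₄₅`, `C₆₇`
serve as pivots of an elimination; a vanishing bordered minor says that the entry `c` disappears
once the rest of its row in the minor has been eliminated, and `S₂` gives what is needed to undo
the row operations by column operations, that is, to conjugate `g` into such an `N`.

The conjugates of the two families of `N` have the same closure: the conditions `α, β, det B ≠ 0`
are dense, and conjugation by block diagonal elements carries antidiagonal `B` and `D` to all
products `U A V` with `U`, `V` unitriangular and `A` antidiagonal, which are dense among all
matrices.
-/

/-! ### Block calculus -/

/-- A real matrix of the size of the block at place `(a, b)`. -/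
abbrev Block (m k : ℕ) (a b : Fin 8) : Type :=
  Matrix (Fin (blockSize m k a)) (Fin (blockSize m k b)) ℝ

/-- A real matrix of the size to which the partition into eight blocks applies. -/
abbrev PartitionedMatrix (m k : ℕ) : Type :=
  Matrix (Fin (matSize m k)) (Fin (matSize m k)) ℝ

section Blocks

variable {m k : ℕ}

instance : Unique (Fin (blockSize m k 1)) := inferInstanceAs (Unique (Fin 1))
instance : Unique (Fin (blockSize m k 2)) := inferInstanceAs (Unique (Fin 1))
instance : Unique (Fin (blockSize m k 5)) := inferInstanceAs (Unique (Fin 1))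
instance : Unique (Fin (blockSize m k 6)) := inferInstanceAs (Unique (Fin 1))

/-- The block of `P` at place `(a, b)`. -/
def block (a b : Fin 8) (P : PartitionedMatrix m k) : Block m k a b :=
  P.submatrix (pos m k a) (pos m k b)

theorem pos_inj {a : Fin 8} {i j : Fin (blockSize m k a)} : pos m k a i = pos m k a j ↔ i = j := by
  simp [pos, Fin.ext_iff]

theorem pos_lt_iff {a : Fin 8} {i j : Fin (blockSize m k a)} :
    pos m k a i < pos m k a j ↔ i < j := by
  simp [pos]

theorem pos_ne_pos {a b : Fin 8} (h : a ≠ b) (i : Fin (blockSize m k a))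
    (j : Fin (blockSize m k b)) : pos m k a i ≠ pos m k b j := by
  rcases h.lt_or_gt with h | h
  · exact (pos_lt_pos h i j).ne
  · exact (pos_lt_pos h j i).ne'

theorem pos_sigma_bijective (m k : ℕ) :
    Function.Bijective fun x : Σ a, Fin (blockSize m k a) => pos m k x.1 x.2 := by
  rw [Fintype.bijective_iff_injective_and_card]
  constructor
  · rintro ⟨a, i⟩ ⟨b, j⟩ h
    obtain rfl : a = b := by_contra fun hab => pos_ne_pos hab i j h
    exact congrArg _ (pos_inj.1 h)
  · simp only [Fintype.card_sigma, Fintype.card_fin, Fin.sum_univ_eight]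
    simp [blockSize, matSize]
    ring

theorem exists_pos_eq (u : Fin (matSize m k)) : ∃ a i, pos m k a i = u :=
  let ⟨⟨a, i⟩, h⟩ := (pos_sigma_bijective m k).2 u
  ⟨a, i, h⟩

theorem sum_eq_sum_pos {R : Type*} [AddCommMonoid R] (f : Fin (matSize m k) → R) :
    ∑ u, f u = ∑ a, ∑ i, f (pos m k a i) := by
  rw [← (pos_sigma_bijective m k).sum_comp, Fintype.sum_sigma]

theorem block_ext {P Q : PartitionedMatrix m k} (h : ∀ a b, block a b P = block a b Q) :
    P = Q := by
  ext u v
  obtain ⟨a, i, rfl⟩ := exists_pos_eq u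
  obtain ⟨b, j, rfl⟩ := exists_pos_eq v
  exact congrFun₂ (h a b) i j

theorem block_mul (a b : Fin 8) (P Q : PartitionedMatrix m k) :
    block a b (P * Q) = ∑ c, block a c P * block c b Q := by
  ext i j
  simp only [block, Matrix.submatrix_apply, Matrix.mul_apply, Matrix.sum_apply]
  exact sum_eq_sum_pos _

theorem block_add (a b : Fin 8) (P Q : PartitionedMatrix m k) :
    block a b (P + Q) = block a b P + block a b Q := rfl

theorem block_sub (a b : Fin 8) (P Q : PartitionedMatrix m k) :
    block a b (P - Q) = block a b P - block a b Q := rfl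

theorem block_one_self (a : Fin 8) : block a a (1 : PartitionedMatrix m k) = 1 := by
  ext i j
  simp [block, Matrix.one_apply, pos_inj]

theorem block_one_of_ne {a b : Fin 8} (h : a ≠ b) :
    block a b (1 : PartitionedMatrix m k) = 0 := by
  ext i j
  simp [block, pos_ne_pos h]

theorem block_ofBlocks (a b : Fin 8) (M : ∀ a b, Block m k a b) :
    block a b (ofBlocks m k M) = M a b := by
  ext i j
  simp only [block, ofBlocks, Matrix.submatrix_apply, Matrix.of_apply]
  rw [Finset.sum_eq_single a, Finset.sum_eq_single b, Finset.sum_eq_single i,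
    Finset.sum_eq_single j] <;>
    simp +contextual [pos_inj, pos_ne_pos]

theorem mem_UT_of_block {P : PartitionedMatrix m k}
    (hdiag : ∀ a, block a a P ∈ UT (blockSize m k a)) (hlow : ∀ a b, b < a → block a b P = 0) :
    P ∈ UT (matSize m k) := by
  constructor
  · intro u
    obtain ⟨a, i, rfl⟩ := exists_pos_eq u
    exact (hdiag a).1 i
  · intro u v h
    obtain ⟨a, i, rfl⟩ := exists_pos_eq u
    obtain ⟨b, j, rfl⟩ := exists_pos_eq v
    rcases lt_trichotomy a b with hab | rfl | hab
    · exact absurd h (pos_lt_pos hab i j).not_gt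
    · exact (hdiag a).2 i j (pos_lt_iff.1 h)
    · exact congrFun₂ (hlow a b hab) i j

theorem block_self_mem_UT (g : UT (matSize m k)) (a : Fin 8) :
    block a a g.1 ∈ UT (blockSize m k a) :=
  ⟨fun _ => g.2.1 _, fun _ _ h => g.2.2 _ _ (pos_lt_iff.2 h)⟩

theorem block_eq_zero_of_lt (g : UT (matSize m k)) {a b : Fin 8} (h : b < a) :
    block a b g.1 = 0 := by
  ext i j
  exact g.2.2 _ _ (pos_lt_pos h j i)

theorem block_self_eq_one (g : UT (matSize m k)) (a : Fin 8)
    [Subsingleton (Fin (blockSize m k a))] :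
    block a a g.1 = 1 := by
  ext i j
  rw [Subsingleton.elim j i, (block_self_mem_UT g a).1 i, Matrix.one_apply_eq]

/-- The element of the group with unit blocks on the diagonal and the blocks `M a b`, `a < b`,
above it. -/
noncomputable def unipotent (M : ∀ a b, Block m k a b) : UT (matSize m k) :=
  ⟨1 + ofBlocks m k fun a b => if a < b then M a b else 0, mem_UT_of_block
    (fun a => by
      rw [block_add, block_ofBlocks, block_one_self, if_neg (lt_irrefl a), add_zero]
      exact one_mem _)
    (fun a b h => by
      rw [block_add, block_ofBlocks, block_one_of_ne h.ne', if_neg h.not_gt, add_zero])⟩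

theorem block_unipotent_self (M : ∀ a b, Block m k a b) (a : Fin 8) :
    block a a (unipotent M).1 = 1 := by
  rw [unipotent, block_add, block_ofBlocks, block_one_self, if_neg (lt_irrefl a), add_zero]

theorem block_unipotent_of_lt (M : ∀ a b, Block m k a b) {a b : Fin 8} (h : a < b) :
    block a b (unipotent M).1 = M a b := by
  rw [unipotent, block_add, block_ofBlocks, block_one_of_ne h.ne, if_pos h, zero_add]

theorem eq_unipotent {g : UT (matSize m k)} {M : ∀ a b, Block m k a b}
    (hdiag : ∀ a, block a a g.1 = 1) (hupper : ∀ a b, a < b → block a b g.1 = M a b) :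
    g = unipotent M := by
  refine Subtype.ext (block_ext fun a b => ?_)
  rcases lt_trichotomy a b with h | rfl | h
  · rw [hupper a b h, block_unipotent_of_lt M h]
  · rw [hdiag, block_unipotent_self]
  · rw [block_eq_zero_of_lt g h, block_eq_zero_of_lt _ h]

theorem continuous_ofBlocks {T : Type*} [TopologicalSpace T] {M : T → ∀ a b, Block m k a b}
    (h : ∀ a b, Continuous fun t => M t a b) : Continuous fun t => ofBlocks m k (M t) := by
  refine continuous_matrix fun u v => ?_
  obtain ⟨a, i, rfl⟩ := exists_pos_eq u
  obtain ⟨b, j, rfl⟩ := exists_pos_eq v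
  exact ((h a b).matrix_elem i j).congr fun t => congrFun₂ (block_ofBlocks a b (M t)).symm i j

theorem continuous_unipotent {T : Type*} [TopologicalSpace T] {M : T → ∀ a b, Block m k a b}
    (h : ∀ a b, Continuous fun t => M t a b) : Continuous fun t => unipotent (M t) := by
  refine (continuous_const.add (continuous_ofBlocks fun a b => ?_)).subtype_mk _
  split_ifs
  exacts [h a b, continuous_const]

end Blocks

/-! ### Antidiagonal matrices -/

section Antidiag

variable {s : ℕ} {ι : Type*}

theorem antidiag_apply (l : Fin s → ℝ) (i j : Fin s) :
    antidiag l i j = if j = i.rev then l j else 0 := by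
  have : (i : ℕ) + j + 1 = s ↔ j = i.rev := by
    rw [Fin.ext_iff, Fin.val_rev]
    omega
  simp only [antidiag, Matrix.of_apply, this]

theorem antidiag_mul_apply (l : Fin s → ℝ) (M : Matrix (Fin s) ι ℝ) (i : Fin s) (j : ι) :
    (antidiag l * M) i j = l i.rev * M i.rev j := by
  simp [Matrix.mul_apply, antidiag_apply]

theorem mul_antidiag_apply (l : Fin s → ℝ) (M : Matrix ι (Fin s) ℝ) (i : ι) (j : Fin s) :
    (M * antidiag l) i j = M i j.rev * l j := by
  have : ∀ x : Fin s, j = x.rev ↔ x = j.rev := fun x => by rw [eq_comm, Fin.rev_eq_iff]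
  simp [Matrix.mul_apply, antidiag_apply, this]

theorem antidiag_mul_eq_zero_iff {l : Fin s → ℝ} (hl : ∀ j, l j ≠ 0) {M : Matrix (Fin s) ι ℝ} :
    antidiag l * M = 0 ↔ M = 0 := by
  refine ⟨fun h => ?_, fun h => by rw [h, Matrix.mul_zero]⟩
  ext i j
  simpa [antidiag_mul_apply, hl] using congrFun₂ h i.rev j

theorem mul_antidiag_eq_zero_iff {l : Fin s → ℝ} (hl : ∀ j, l j ≠ 0) {M : Matrix ι (Fin s) ℝ} :
    M * antidiag l = 0 ↔ M = 0 := by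
  refine ⟨fun h => ?_, fun h => by rw [h, Matrix.zero_mul]⟩
  ext i j
  simpa [mul_antidiag_apply, hl] using congrFun₂ h i j.rev

theorem det_antidiag_ne_zero {l : Fin s → ℝ} (hl : ∀ j, l j ≠ 0) : (antidiag l).det ≠ 0 :=
  fun h => by
    obtain ⟨v, hv, hlv⟩ := Matrix.exists_mulVec_eq_zero_iff.2 h
    refine hv (Matrix.replicateCol_eq_zero (ι := Unit) v |>.1 ?_)
    rw [← antidiag_mul_eq_zero_iff hl, ← Matrix.replicateCol_mulVec, hlv, Matrix.replicateCol_zero]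

theorem blockTriangular_antidiag_mul_antidiag (a b : Fin s → ℝ) :
    (antidiag a * antidiag b).BlockTriangular id := fun i j h => by
  rw [antidiag_mul_apply, antidiag_apply, Fin.rev_rev, if_neg (show j ≠ i from ne_of_lt h),
    mul_zero]

theorem continuous_antidiag : Continuous (antidiag : (Fin s → ℝ) → Matrix (Fin s) (Fin s) ℝ) := by
  refine continuous_matrix fun i j => ?_
  simp only [antidiag_apply]
  split_ifs
  exacts [continuous_apply j, continuous_const]

theorem UT.eq_one {P : Matrix (Fin s) (Fin s) ℝ} (hP : P ∈ UT s)
    (h : ∀ i j, i < j → P i j = 0) : P = 1 := by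
  ext i j
  rcases lt_trichotomy i j with hij | rfl | hij
  · rw [h i j hij, Matrix.one_apply_ne hij.ne]
  · rw [hP.1, Matrix.one_apply_eq]
  · rw [hP.2 i j hij, Matrix.one_apply_ne hij.ne']

variable {l : Fin s → ℝ} (hl : ∀ j : Fin s, (j : ℕ) + 1 < s → l j ≠ 0)

include hl

theorem ne_zero_of_lt_rev {i j : Fin s} (h : i < j.rev) : l i ≠ 0 :=
  hl i (by simp only [Fin.lt_def, Fin.val_rev] at h; omega)

theorem eq_one_of_mul_antidiag_eq {U V : Matrix (Fin s) (Fin s) ℝ} (hU : U ∈ UT s) (hV : V ∈ UT s)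
    (h : U * antidiag l = antidiag l * V) : U = 1 ∧ V = 1 := by
  have key (i j) : U i j.rev * l j = l i.rev * V i.rev j := by
    rw [← mul_antidiag_apply, h, antidiag_mul_apply]
  refine ⟨UT.eq_one hU fun i j hij => ?_, UT.eq_one hV fun i j hij => ?_⟩
  · have hrev := Fin.rev_lt_rev.2 hij
    have := key i j.rev
    rw [Fin.rev_rev, hV.2 _ _ hrev, mul_zero] at this
    exact (mul_eq_zero.1 this).resolve_right (ne_zero_of_lt_rev hl hrev)
  · have hrev := Fin.rev_lt_rev.2 hij
    have := key i.rev j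
    rw [Fin.rev_rev, hU.2 _ _ hrev, zero_mul, eq_comm] at this
    exact (mul_eq_zero.1 this).resolve_left
      (ne_zero_of_lt_rev hl (j := j.rev) (by rwa [Fin.rev_rev]))

theorem exists_eq_antidiag {X : Matrix (Fin s) (Fin s) ℝ}
    (h₁ : (X * antidiag l).BlockTriangular id) (h₂ : (antidiag l * X).BlockTriangular id) :
    ∃ x, X = antidiag x := by
  refine ⟨fun j => X j.rev j, ?_⟩
  ext i j
  rw [antidiag_apply]
  split_ifs with hj
  · rw [hj, Fin.rev_rev]
  · rcases lt_or_gt_of_ne hj with hj | hj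
    · have := h₂ (show id j < id i.rev from hj)
      rw [antidiag_mul_apply, Fin.rev_rev] at this
      exact (mul_eq_zero.1 this).resolve_left
        (ne_zero_of_lt_rev hl (j := j) (by rwa [Fin.lt_rev_iff]))
    · have := h₁ (show id j.rev < id i by rwa [id, id, Fin.rev_lt_iff])
      rw [mul_antidiag_apply, Fin.rev_rev] at this
      exact (mul_eq_zero.1 this).resolve_right
        (ne_zero_of_lt_rev hl (j := i.rev) (by rwa [Fin.rev_rev, Fin.rev_lt_iff]))

end Antidiag

/-! ### The big cell -/

section BigCell

variable {s t n : ℕ}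

/-- The matrices `U A V` with `U`, `V` unitriangular and `A` antidiagonal. When the entries of `A`
are nonzero they form the big cell of the Bruhat decomposition of `GL(s)`. -/
def bigCell (s : ℕ) : Set (Matrix (Fin s) (Fin s) ℝ) :=
  {B | ∃ U V : UT s, ∃ b, B = U.1 * antidiag b * V.1}

theorem UT.submatrix_fromBlocks_mem {e : Fin s ⊕ Fin t ≃ Fin n} (hl : StrictMono (e ∘ Sum.inl))
    (hr : StrictMono (e ∘ Sum.inr)) (hlr : ∀ i j, e (Sum.inl i) < e (Sum.inr j))
    {U : Matrix (Fin s) (Fin s) ℝ} (hU : U ∈ UT s) (X : Matrix (Fin s) (Fin t) ℝ)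
    {V : Matrix (Fin t) (Fin t) ℝ} (hV : V ∈ UT t) :
    (Matrix.fromBlocks U X 0 V).submatrix e.symm e.symm ∈ UT n := by
  refine ⟨fun u => ?_, fun u v h => ?_⟩
  · obtain ⟨x | x, rfl⟩ := e.surjective u
    exacts [by simpa using hU.1 x, by simpa using hV.1 x]
  · obtain ⟨x | x, rfl⟩ := e.surjective u <;> obtain ⟨y | y, rfl⟩ := e.surjective v
    · simpa using hU.2 x y (hl.lt_iff_lt.1 h)
    · exact absurd h (hlr x y).not_gt
    · simp
    · simpa using hV.2 x y (hr.lt_iff_lt.1 h)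

/-- Concatenation of `s` rows and a last row. -/
def lastRowEquiv (s : ℕ) : Fin s ⊕ Fin 1 ≃ Fin (s + 1) := finSumFinEquiv

/-- Concatenation of a first column and `s` columns. -/
def firstColEquiv (s : ℕ) : Fin 1 ⊕ Fin s ≃ Fin (s + 1) :=
  finSumFinEquiv.trans (finCongr (add_comm 1 s))

theorem lastRowEquiv_inl (i : Fin s) : lastRowEquiv s (Sum.inl i) = i.castSucc := rfl

theorem lastRowEquiv_inr (i : Fin 1) : lastRowEquiv s (Sum.inr i) = Fin.last s := by
  simp [lastRowEquiv, Fin.ext_iff]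

theorem firstColEquiv_inl (i : Fin 1) : firstColEquiv s (Sum.inl i) = 0 := by
  simp [firstColEquiv, Fin.ext_iff]

theorem firstColEquiv_inr (i : Fin s) : firstColEquiv s (Sum.inr i) = i.succ := by
  simp [firstColEquiv]

theorem lastRow_mem_UT {U : Matrix (Fin s) (Fin s) ℝ} (hU : U ∈ UT s)
    (x : Matrix (Fin s) (Fin 1) ℝ) :
    (Matrix.fromBlocks U x 0 1).submatrix (lastRowEquiv s).symm (lastRowEquiv s).symm ∈
      UT (s + 1) :=
  UT.submatrix_fromBlocks_mem (fun _ _ h => by simpa [lastRowEquiv_inl] using h)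
    (Subsingleton.strictMono _)
    (fun i j => by simp [lastRowEquiv_inl, lastRowEquiv_inr]) hU x (one_mem _)

theorem firstCol_mem_UT {V : Matrix (Fin s) (Fin s) ℝ} (hV : V ∈ UT s)
    (y : Matrix (Fin 1) (Fin s) ℝ) :
    (Matrix.fromBlocks 1 y 0 V).submatrix (firstColEquiv s).symm (firstColEquiv s).symm ∈
      UT (s + 1) :=
  UT.submatrix_fromBlocks_mem (Subsingleton.strictMono _)
    (fun _ _ h => by simpa [firstColEquiv_inr] using h)
    (fun i j => by simp [firstColEquiv_inl, firstColEquiv_inr]) (one_mem _) y hV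

theorem submatrix_fromBlocks_antidiag (b : Fin s → ℝ) (δ : Matrix (Fin 1) (Fin 1) ℝ) :
    (Matrix.fromBlocks 0 (antidiag b) δ 0).submatrix (lastRowEquiv s).symm (firstColEquiv s).symm =
      antidiag (Fin.cons (δ 0 0) b) := by
  ext u v
  obtain ⟨x | x, rfl⟩ := (lastRowEquiv s).surjective u <;>
    obtain ⟨y | y, rfl⟩ := (firstColEquiv s).surjective v <;>
    simp only [Matrix.submatrix_apply, Equiv.symm_apply_apply, Matrix.fromBlocks_apply₁₁,
      Matrix.fromBlocks_apply₁₂, Matrix.fromBlocks_apply₂₁, Matrix.fromBlocks_apply₂₂]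
  · simp [antidiag, lastRowEquiv_inl, firstColEquiv_inl, x.2.ne]
  · simp [antidiag, lastRowEquiv_inl, firstColEquiv_inr, ← add_assoc]
  · simp [antidiag, lastRowEquiv_inr, firstColEquiv_inl, Fin.fin_one_eq_zero]
  · simp [antidiag, lastRowEquiv_inr, firstColEquiv_inr]

/-- With `S = A - x δ⁻¹ y`, one has
`(x A; δ y) = (1 xδ⁻¹; 0 1) (0 S; δ 0) (1 δ⁻¹y; 0 1)`, and `S` is approximated by the big cell. -/
theorem mem_closure_bigCell {M : Matrix (Fin (s + 1)) (Fin (s + 1)) ℝ} (hM : M (Fin.last s) 0 ≠ 0)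
    (hs : Dense (bigCell s)) : M ∈ closure (bigCell (s + 1)) := by
  obtain ⟨x, A, δ, y, hN⟩ : ∃ x A δ y,
      M.submatrix (lastRowEquiv s) (firstColEquiv s) = Matrix.fromBlocks x A δ y :=
    ⟨_, _, _, _, (Matrix.fromBlocks_toBlocks _).symm⟩
  have hδ : IsUnit δ := by
    have : δ 0 0 = M (Fin.last s) 0 := (congrFun₂ hN (Sum.inr 0) (Sum.inl 0)).symm.trans <| by
      rw [Matrix.submatrix_apply, lastRowEquiv_inr, firstColEquiv_inl]
    rwa [Matrix.isUnit_iff_isUnit_det, Matrix.det_fin_one, this, isUnit_iff_ne_zero]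
  obtain ⟨ε, hδε, hεδ⟩ := isUnit_iff_exists.1 hδ
  let f (S : Matrix (Fin s) (Fin s) ℝ) : Matrix (Fin (s + 1)) (Fin (s + 1)) ℝ :=
    (Matrix.fromBlocks x (S + x * ε * y) δ y).submatrix
      (lastRowEquiv s).symm (firstColEquiv s).symm
  have hf : Continuous f := by fun_prop
  have hf_mem : Set.MapsTo f (bigCell s) (bigCell (s + 1)) := by
    rintro _ ⟨U, V, b, rfl⟩
    refine ⟨⟨_, lastRow_mem_UT U.2 (x * ε)⟩, ⟨_, firstCol_mem_UT V.2 (ε * y)⟩,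
      Fin.cons (δ 0 0) b, ?_⟩
    rw [← submatrix_fromBlocks_antidiag]
    simp [f, Matrix.submatrix_mul_equiv, Matrix.fromBlocks_multiply, ← Matrix.mul_assoc, hδε,
      Matrix.mul_assoc _ ε δ, hεδ, add_comm]
  have hfM : f (A - x * ε * y) = M := by
    simp only [f, sub_add_cancel, ← hN, Matrix.submatrix_submatrix, Equiv.self_comp_symm,
      Matrix.submatrix_id_id]
  exact hfM ▸ map_mem_closure hf (hs _) hf_mem

theorem dense_ne_zero_apply {α β : Type*} (i : α) (j : β) :
    Dense {M : Matrix α β ℝ | M i j ≠ 0} :=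
  (dense_compl_singleton (0 : ℝ)).preimage ((isOpenMap_eval j).comp (isOpenMap_eval i))

theorem dense_bigCell (s : ℕ) : Dense (bigCell s) := by
  induction s with
  | zero => exact fun B => subset_closure ⟨1, 1, 0, Subsingleton.elim _ _⟩
  | succ s ih =>
    refine ((dense_ne_zero_apply (Fin.last s) 0).mono fun M hM => ?_).of_closure
    exact mem_closure_bigCell hM ih

end BigCell

/-! ### Block supports -/

section BlockSupport

variable {m k : ℕ} {S T : Finset (Fin 8 × Fin 8)} {P Q : PartitionedMatrix m k}

/-- All blocks of `P` at places outside `S` vanish. The places are kept in a `Finset`, so that the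
vanishing of a block of a product is decided by computation. -/
def HasBlockSupport (S : Finset (Fin 8 × Fin 8)) (P : PartitionedMatrix m k) : Prop :=
  ∀ a b, (a, b) ∉ S → block a b P = 0

theorem HasBlockSupport.block_mul_eq_sum (hP : HasBlockSupport S P) (hQ : HasBlockSupport T Q)
    {a b : Fin 8} (C : Finset (Fin 8)) (h : ∀ c ∉ C, (a, c) ∉ S ∨ (c, b) ∉ T) :
    block a b (P * Q) = ∑ c ∈ C, block a c P * block c b Q := by
  rw [block_mul]
  refine (Finset.sum_subset (Finset.subset_univ C) fun c _ hc => ?_).symm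
  rcases h c hc with h | h
  · rw [hP a c h, Matrix.zero_mul]
  · rw [hQ c b h, Matrix.mul_zero]

theorem HasBlockSupport.block_mul_eq_zero (hP : HasBlockSupport S P) (hQ : HasBlockSupport T Q)
    {a b : Fin 8} (h : ∀ c, (a, c) ∉ S ∨ (c, b) ∉ T) : block a b (P * Q) = 0 :=
  hP.block_mul_eq_sum hQ ∅ fun c _ => h c

theorem HasBlockSupport.block_mul_eq_mul (hP : HasBlockSupport S P) (hQ : HasBlockSupport T Q)
    {a b : Fin 8} (c : Fin 8) (h : ∀ c', c' ≠ c → (a, c') ∉ S ∨ (c', b) ∉ T) :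
    block a b (P * Q) = block a c P * block c b Q :=
  (hP.block_mul_eq_sum hQ {c} fun c' hc => h c' (Finset.notMem_singleton.1 hc)).trans
    (Finset.sum_singleton _ _)

theorem HasBlockSupport.block_mul_eq_add (hP : HasBlockSupport S P) (hQ : HasBlockSupport T Q)
    {a b : Fin 8} (c d : Fin 8) (hcd : c ≠ d)
    (h : ∀ c' ∉ ({c, d} : Finset (Fin 8)), (a, c') ∉ S ∨ (c', b) ∉ T) :
    block a b (P * Q) = block a c P * block c b Q + block a d P * block d b Q :=
  (hP.block_mul_eq_sum hQ {c, d} h).trans (Finset.sum_pair hcd)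

/-- The places on and above the diagonal, except the places of the diagonal blocks of size one. -/
def nilpotentSupport : Finset (Fin 8 × Fin 8) :=
  Finset.univ.filter fun p => p.1 < p.2 ∨ p.1 = p.2 ∧ p.1 ∉ ({1, 2, 5, 6} : Finset (Fin 8))

theorem block_sub_one_of_ne (P : PartitionedMatrix m k) {a b : Fin 8} (h : a ≠ b) :
    block a b (P - 1) = block a b P := by
  rw [block_sub, block_one_of_ne h, sub_zero]

theorem block_self_eq_one_of_mem (g : UT (matSize m k)) {a : Fin 8}
    (ha : a ∈ ({1, 2, 5, 6} : Finset (Fin 8))) : block a a g.1 = 1 := by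
  simp only [Finset.mem_insert, Finset.mem_singleton] at ha
  rcases ha with rfl | rfl | rfl | rfl <;> exact block_self_eq_one g _

theorem hasBlockSupport_sub_one (g : UT (matSize m k)) :
    HasBlockSupport nilpotentSupport (g.1 - 1) := by
  intro a b h
  simp only [nilpotentSupport, Finset.mem_filter, Finset.mem_univ, true_and, not_or, not_lt,
    not_and, not_not] at h
  obtain hab | rfl := h.1.lt_or_eq
  · rw [block_sub_one_of_ne _ hab.ne', block_eq_zero_of_lt g hab]
  · rw [block_sub, block_one_self, block_self_eq_one_of_mem g (h.2 rfl), sub_self]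

end BlockSupport

/-! ### The normal form -/

section NormalForm

variable {m k : ℕ}

/-- The places above the diagonal where `normalForm` may have nonzero blocks. -/
def normalSupport : Finset (Fin 8 × Fin 8) :=
  {(1, 2), (5, 6), (1, 5), (1, 6), (2, 6), (3, 4), (0, 7)}

/-- The blocks of `normalForm` above the diagonal. -/
def normalBlocks (α β p q r : ℝ) (B : Matrix (Fin k) (Fin k) ℝ) (D : Matrix (Fin m) (Fin m) ℝ)
    (a b : Fin 8) : Block m k a b :=
  match a, b with
  | 1, 2 => Matrix.of fun _ _ => α
  | 5, 6 => Matrix.of fun _ _ => β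
  | 1, 5 => Matrix.of fun _ _ => p
  | 1, 6 => Matrix.of fun _ _ => q
  | 2, 6 => Matrix.of fun _ _ => r
  | 3, 4 => B
  | 0, 7 => D
  | _, _ => 0

/-- The normal form of the elements of `Ann I'` under conjugation, which is also the shape of the
elements of `G^f`: unit blocks on the diagonal, the blocks `α`, `β`, `p`, `q`, `r`, `B`, `D` at the
places `(2,3)`, `(6,7)`, `(2,6)`, `(2,7)`, `(3,7)`, `(4,5)`, `(1,8)` (counted from one) and zero
blocks elsewhere. -/
noncomputable def normalForm (α β p q r : ℝ) (B : Matrix (Fin k) (Fin k) ℝ)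
    (D : Matrix (Fin m) (Fin m) ℝ) : UT (matSize m k) :=
  unipotent (normalBlocks α β p q r B D)

theorem normalBlocks_eq_zero (α β p q r : ℝ) (B : Matrix (Fin k) (Fin k) ℝ)
    (D : Matrix (Fin m) (Fin m) ℝ) {a b : Fin 8} (h : (a, b) ∉ normalSupport) :
    normalBlocks α β p q r B D a b = 0 := by
  fin_cases a <;> fin_cases b <;> first | rfl | exact absurd (by decide) h

section

variable (α β p q r : ℝ) (B : Matrix (Fin k) (Fin k) ℝ) (D : Matrix (Fin m) (Fin m) ℝ)

theorem block_normalForm_one_two :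
    block 1 2 (normalForm α β p q r B D).1 = Matrix.of fun _ _ => α :=
  block_unipotent_of_lt _ (by decide)

theorem block_normalForm_five_six :
    block 5 6 (normalForm α β p q r B D).1 = Matrix.of fun _ _ => β :=
  block_unipotent_of_lt _ (by decide)

theorem block_normalForm_three_four : block 3 4 (normalForm α β p q r B D).1 = B :=
  block_unipotent_of_lt _ (by decide)

theorem block_normalForm_zero_seven : block 0 7 (normalForm α β p q r B D).1 = D :=
  block_unipotent_of_lt _ (by decide)

end

theorem block_normalForm_sub_one (α β p q r : ℝ) (B : Matrix (Fin k) (Fin k) ℝ)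
    (D : Matrix (Fin m) (Fin m) ℝ) (a b : Fin 8) :
    block a b ((normalForm α β p q r B D).1 - 1) = normalBlocks α β p q r B D a b := by
  have hlow : ∀ a b, b ≤ a → (a, b) ∉ normalSupport := by decide
  rcases lt_trichotomy a b with hab | rfl | hab
  · rw [block_sub_one_of_ne _ hab.ne, normalForm, block_unipotent_of_lt _ hab]
  · rw [block_sub, normalForm, block_unipotent_self, block_one_self, sub_self,
      normalBlocks_eq_zero _ _ _ _ _ _ _ (hlow a a le_rfl)]
  · rw [block_sub_one_of_ne _ hab.ne', block_eq_zero_of_lt _ hab,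
      normalBlocks_eq_zero _ _ _ _ _ _ _ (hlow a b hab.le)]

theorem hasBlockSupport_normalForm_sub_one (α β p q r : ℝ) (B : Matrix (Fin k) (Fin k) ℝ)
    (D : Matrix (Fin m) (Fin m) ℝ) :
    HasBlockSupport normalSupport ((normalForm α β p q r B D).1 - 1) := fun a b h => by
  rw [block_normalForm_sub_one, normalBlocks_eq_zero _ _ _ _ _ _ _ h]

theorem continuous_normalForm {T : Type*} [TopologicalSpace T] {α β p q r : T → ℝ}
    {B : T → Matrix (Fin k) (Fin k) ℝ} {D : T → Matrix (Fin m) (Fin m) ℝ} (hα : Continuous α)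
    (hβ : Continuous β) (hp : Continuous p) (hq : Continuous q) (hr : Continuous r)
    (hB : Continuous B) (hD : Continuous D) :
    Continuous fun t => normalForm (α t) (β t) (p t) (q t) (r t) (B t) (D t) := by
  refine continuous_unipotent fun a b => ?_
  by_cases h : (a, b) ∈ normalSupport
  · simp only [normalSupport, Finset.mem_insert, Finset.mem_singleton, Prod.mk.injEq] at h
    rcases h with ⟨rfl, rfl⟩ | ⟨rfl, rfl⟩ | ⟨rfl, rfl⟩ | ⟨rfl, rfl⟩ | ⟨rfl, rfl⟩ | ⟨rfl, rfl⟩ |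
      ⟨rfl, rfl⟩
    exacts [continuous_matrix fun _ _ => hα, continuous_matrix fun _ _ => hβ,
      continuous_matrix fun _ _ => hp, continuous_matrix fun _ _ => hq,
      continuous_matrix fun _ _ => hr, hB, hD]
  · simp_rw [normalBlocks_eq_zero _ _ _ _ _ _ _ h]
    exact continuous_const

end NormalForm

/-! ### The stabilizer -/

section Stabilizer

theorem const_mul_const {ι κ σ : Type*} [Unique κ] [Fintype κ] (α β : ℝ) :
    (Matrix.of fun (_ : ι) (_ : κ) => α) * (Matrix.of fun (_ : κ) (_ : σ) => β) =
      Matrix.of fun _ _ => α * β := by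
  ext i j
  simp [Matrix.mul_apply]

theorem UT.blockTriangular {n : ℕ} (g : UT n) : g.1.BlockTriangular id := fun i j h => g.2.2 i j h

theorem UT.coe_mul_coe_inv {n : ℕ} (g : UT n) : g.1 * (g⁻¹).1 = 1 :=
  congrArg Subtype.val (mul_inv_cancel g)

theorem UT.coe_inv_mul_coe {n : ℕ} (g : UT n) : (g⁻¹).1 * g.1 = 1 :=
  congrArg Subtype.val (inv_mul_cancel g)

theorem coadj_traceDual_apply {n : ℕ} (g : UT n) (F : Matrix (Fin n) (Fin n) ℝ) (x : ut n) :
    coadj g (traceDual F) x = (g.1 * F * (g⁻¹).1 * x.1).trace := by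
  have : coadj g (traceDual F) x = (F * ((g⁻¹).1 * x.1 * (g⁻¹⁻¹).1)).trace := rfl
  rw [this, inv_inv, ← Matrix.mul_assoc, Matrix.trace_mul_comm]
  simp only [Matrix.mul_assoc]

theorem traceDual_eq_traceDual_iff {n : ℕ} {F F' : Matrix (Fin n) (Fin n) ℝ} :
    traceDual F = traceDual F' ↔ (F - F').BlockTriangular id := by
  constructor
  · intro h i j hij
    have hx : Matrix.single j i (1 : ℝ) ∈ ut n := fun a b hab =>
      Matrix.single_apply_of_ne _ _ _ _ _ fun ⟨h₁, h₂⟩ => (h₁ ▸ h₂ ▸ hab).not_gt hij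
    have : (F * Matrix.single j i (1 : ℝ)).trace = (F' * Matrix.single j i (1 : ℝ)).trace :=
      LinearMap.congr_fun h ⟨_, hx⟩
    simpa [Matrix.trace_mul_single, sub_eq_zero] using this
  · intro h
    ext x
    change (F * x.1).trace = (F' * x.1).trace
    rw [← sub_eq_zero, ← Matrix.trace_sub, ← Matrix.sub_mul, Matrix.trace]
    refine Finset.sum_eq_zero fun i _ => ?_
    rw [Matrix.diag_apply, Matrix.mul_apply]
    refine Finset.sum_eq_zero fun j _ => ?_
    rcases lt_or_ge j i with hij | hij
    · rw [h hij, zero_mul]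
    · rw [x.2 j i hij, mul_zero]

theorem coadj_traceDual {n : ℕ} (g : UT n) (F : Matrix (Fin n) (Fin n) ℝ) :
    coadj g (traceDual F) = traceDual (g.1 * F * (g⁻¹).1) :=
  LinearMap.ext fun x => coadj_traceDual_apply g F x

theorem mem_coadjStabilizer_iff {n : ℕ} (F : Matrix (Fin n) (Fin n) ℝ) (g : UT n) :
    g ∈ coadjStabilizer (traceDual F) ↔
      ((g.1 - 1) * F - F * (g.1 - 1)).BlockTriangular id := by
  have h₁ : (g.1 * F * (g⁻¹).1 - F) * g.1 = (g.1 - 1) * F - F * (g.1 - 1) := by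
    rw [Matrix.sub_mul, Matrix.mul_assoc (g.1 * F), UT.coe_inv_mul_coe]
    noncomm_ring
  have h₂ : ((g.1 - 1) * F - F * (g.1 - 1)) * (g⁻¹).1 = g.1 * F * (g⁻¹).1 - F := by
    rw [← h₁, Matrix.mul_assoc, UT.coe_mul_coe_inv, Matrix.mul_one]
  rw [coadjStabilizer, Set.mem_ofPred_eq, coadj_traceDual, traceDual_eq_traceDual_iff]
  exact ⟨fun h => h₁ ▸ h.mul (UT.blockTriangular _), fun h => h₂ ▸ h.mul (UT.blockTriangular _)⟩

variable {m k : ℕ}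

theorem blockTriangular_iff_block {P : PartitionedMatrix m k} :
    P.BlockTriangular id ↔
      (∀ a b, b < a → block a b P = 0) ∧ ∀ a, (block a a P).BlockTriangular id := by
  constructor
  · refine fun h => ⟨fun a b hab => ?_, fun a i j hij => h (pos_lt_iff.2 hij)⟩
    ext i j
    exact h (pos_lt_pos hab j i)
  · rintro ⟨hlow, hdiag⟩ u v huv
    obtain ⟨a, i, rfl⟩ := exists_pos_eq u
    obtain ⟨b, j, rfl⟩ := exists_pos_eq v
    rcases lt_trichotomy a b with hab | rfl | hab
    · exact absurd huv (pos_lt_pos hab i j).not_gt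
    · exact hdiag a (pos_lt_iff.1 huv)
    · exact congrFun₂ (hlow a b hab) i j

/-- The places of the blocks of `fMatrix` that may be different from zero. -/
def fSupport : Finset (Fin 8 × Fin 8) := {(7, 0), (4, 3), (5, 1), (6, 2), (6, 5)}

variable {l₁ : Fin m → ℝ} {l₂ : Fin k → ℝ} {γ₁ γ₂ γ₃ : ℝ}

theorem hasBlockSupport_fMatrix : HasBlockSupport fSupport (fMatrix m k l₁ l₂ γ₁ γ₂ γ₃) := by
  intro a b h
  rw [fMatrix, block_ofBlocks]
  fin_cases a <;> fin_cases b <;> first | rfl | exact absurd (by decide) h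

theorem block_fMatrix_seven_zero :
    block 7 0 (fMatrix m k l₁ l₂ γ₁ γ₂ γ₃) = antidiag l₁ := block_ofBlocks 7 0 _

theorem block_fMatrix_four_three :
    block 4 3 (fMatrix m k l₁ l₂ γ₁ γ₂ γ₃) = antidiag l₂ := block_ofBlocks 4 3 _

theorem block_fMatrix_five_one :
    block 5 1 (fMatrix m k l₁ l₂ γ₁ γ₂ γ₃) = Matrix.of fun _ _ => γ₁ := block_ofBlocks 5 1 _

theorem block_fMatrix_six_two :
    block 6 2 (fMatrix m k l₁ l₂ γ₁ γ₂ γ₃) = Matrix.of fun _ _ => γ₂ := block_ofBlocks 6 2 _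

theorem blockTriangular_of_subsingleton {ι : Type*} [LinearOrder ι] [Subsingleton ι]
    (P : Matrix ι ι ℝ) : P.BlockTriangular id := fun i j h =>
  absurd h (Subsingleton.elim i j ▸ lt_irrefl _)

theorem eq_zero_of_const_mul_eq_zero {ι κ σ : Type*} [Nonempty ι] [Unique κ] {γ : ℝ} (hγ : γ ≠ 0)
    {X : Matrix κ σ ℝ} (h : (Matrix.of fun (_ : ι) (_ : κ) => γ) * X = 0) : X = 0 := by
  ext i j
  rw [Unique.eq_default i]
  simpa [Matrix.mul_apply, hγ] using congrFun₂ h (Classical.arbitrary ι) j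

theorem eq_zero_of_mul_const_eq_zero {ι κ σ : Type*} [Nonempty ι] [Unique κ] {γ : ℝ} (hγ : γ ≠ 0)
    {X : Matrix σ κ ℝ} (h : X * (Matrix.of fun (_ : κ) (_ : ι) => γ) = 0) : X = 0 := by
  ext i j
  rw [Unique.eq_default j]
  simpa [Matrix.mul_apply, hγ] using congrFun₂ h i (Classical.arbitrary ι)

variable {S T : Finset (Fin 8 × Fin 8)} {N F : PartitionedMatrix m k}

theorem block_mul_eq_of_commutator (h : (N * F - F * N).BlockTriangular id) {a b : Fin 8}
    (hab : b < a) : block a b (N * F) = block a b (F * N) :=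
  sub_eq_zero.1 ((blockTriangular_iff_block.1 h).1 a b hab)

theorem HasBlockSupport.mul_eq_mul_of_commutator (hN : HasBlockSupport S N)
    (hF : HasBlockSupport T F) (h : (N * F - F * N).BlockTriangular id) {a b : Fin 8} (c c' : Fin 8)
    (hab : b < a) (hc : ∀ d, d ≠ c → (a, d) ∉ S ∨ (d, b) ∉ T)
    (hc' : ∀ d, d ≠ c' → (a, d) ∉ T ∨ (d, b) ∉ S) :
    block a c N * block c b F = block a c' F * block c' b N := by
  rw [← hN.block_mul_eq_mul hF c hc, ← hF.block_mul_eq_mul hN c' hc',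
    block_mul_eq_of_commutator h hab]

theorem HasBlockSupport.mul_eq_zero_of_commutator_left (hN : HasBlockSupport S N)
    (hF : HasBlockSupport T F) (h : (N * F - F * N).BlockTriangular id) {a b : Fin 8} (c : Fin 8)
    (hc : b < a ∧ (∀ d, d ≠ c → (a, d) ∉ S ∨ (d, b) ∉ T) ∧ ∀ d, (a, d) ∉ T ∨ (d, b) ∉ S) :
    block a c N * block c b F = 0 := by
  rw [← hN.block_mul_eq_mul hF c hc.2.1, block_mul_eq_of_commutator h hc.1,
    hF.block_mul_eq_zero hN hc.2.2]

theorem HasBlockSupport.mul_eq_zero_of_commutator_right (hN : HasBlockSupport S N)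
    (hF : HasBlockSupport T F) (h : (N * F - F * N).BlockTriangular id) {a b : Fin 8} (c : Fin 8)
    (hc : b < a ∧ (∀ d, d ≠ c → (a, d) ∉ T ∨ (d, b) ∉ S) ∧ ∀ d, (a, d) ∉ S ∨ (d, b) ∉ T) :
    block a c F * block c b N = 0 := by
  rw [← hF.block_mul_eq_mul hN c hc.2.1, ← block_mul_eq_of_commutator h hc.1,
    hN.block_mul_eq_zero hF hc.2.2]

variable {g : UT (matSize m k)}

theorem block_self_eq_one_of_commutator (hl₁ : ∀ j, l₁ j ≠ 0)
    (hl₂ : ∀ j : Fin k, (j : ℕ) + 1 < k → l₂ j ≠ 0)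
    (h : ((g.1 - 1) * fMatrix m k l₁ l₂ γ₁ γ₂ γ₃ -
      fMatrix m k l₁ l₂ γ₁ γ₂ γ₃ * (g.1 - 1)).BlockTriangular id) (a : Fin 8) :
    block a a g.1 = 1 := by
  have hN := hasBlockSupport_sub_one g
  have hF := hasBlockSupport_fMatrix (l₁ := l₁) (l₂ := l₂) (γ₁ := γ₁) (γ₂ := γ₂) (γ₃ := γ₃)
  have cancel {s : ℕ} {U V L : Matrix (Fin s) (Fin s) ℝ} (h : (U - 1) * L = L * (V - 1)) :
      U * L = L * V := by
    rwa [Matrix.sub_mul, Matrix.mul_sub, Matrix.one_mul, Matrix.mul_one, sub_left_inj] at h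
  have h₇₀ := hN.mul_eq_mul_of_commutator hF h (a := 7) (b := 0) 7 0 (by decide) (by decide)
    (by decide)
  have h₄₃ := hN.mul_eq_mul_of_commutator hF h (a := 4) (b := 3) 4 3 (by decide) (by decide)
    (by decide)
  rw [block_sub, block_sub, block_one_self, block_one_self] at h₇₀ h₄₃
  rw [block_fMatrix_seven_zero] at h₇₀
  rw [block_fMatrix_four_three] at h₄₃
  have h₁ := eq_one_of_mul_antidiag_eq (fun j _ => hl₁ j) (block_self_mem_UT g 7)
    (block_self_mem_UT g 0) (cancel h₇₀)
  have h₂ := eq_one_of_mul_antidiag_eq hl₂ (block_self_mem_UT g 4) (block_self_mem_UT g 3)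
    (cancel h₄₃)
  by_cases ha : a ∈ ({1, 2, 5, 6} : Finset (Fin 8))
  · exact block_self_eq_one_of_mem g ha
  · have : a = 0 ∨ a = 3 ∨ a = 4 ∨ a = 7 := by revert a; decide
    rcases this with rfl | rfl | rfl | rfl
    exacts [h₁.2, h₂.2, h₂.1, h₁.1]

theorem hasBlockSupport_normalSupport (hl₁ : ∀ j, l₁ j ≠ 0)
    (hl₂ : ∀ j : Fin k, (j : ℕ) + 1 < k → l₂ j ≠ 0) (hγ₁ : γ₁ ≠ 0) (hγ₂ : γ₂ ≠ 0)
    (h : ((g.1 - 1) * fMatrix m k l₁ l₂ γ₁ γ₂ γ₃ -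
      fMatrix m k l₁ l₂ γ₁ γ₂ γ₃ * (g.1 - 1)).BlockTriangular id) :
    HasBlockSupport normalSupport (g.1 - 1) := by
  have hN := hasBlockSupport_sub_one g
  have hF := hasBlockSupport_fMatrix (l₁ := l₁) (l₂ := l₂) (γ₁ := γ₁) (γ₂ := γ₂) (γ₃ := γ₃)
  have row₀ : ∀ b ∈ Finset.Icc 1 6, block 0 b (g.1 - 1) = 0 := fun b hb => by
    have := hN.mul_eq_zero_of_commutator_right hF h (a := 7) (b := b) 0 (by revert b; decide)
    rw [block_fMatrix_seven_zero] at this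
    exact (antidiag_mul_eq_zero_iff hl₁).1 this
  have row₁ : ∀ b ∈ Finset.Icc 3 4, block 1 b (g.1 - 1) = 0 := fun b hb => by
    have := hN.mul_eq_zero_of_commutator_right hF h (a := 5) (b := b) 1 (by revert b; decide)
    rw [block_fMatrix_five_one] at this
    exact eq_zero_of_const_mul_eq_zero hγ₁ this
  have row₂ : ∀ b ∈ Finset.Icc 3 5, block 2 b (g.1 - 1) = 0 := fun b hb => by
    have := hN.mul_eq_zero_of_commutator_right hF h (a := 6) (b := b) 2 (by revert b; decide)
    rw [block_fMatrix_six_two] at this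
    exact eq_zero_of_const_mul_eq_zero hγ₂ this
  have col₇ : ∀ a ∈ Finset.Icc 1 6, block a 7 (g.1 - 1) = 0 := fun a ha => by
    have := hN.mul_eq_zero_of_commutator_left hF h (a := a) (b := 0) 7 (by revert a; decide)
    rw [block_fMatrix_seven_zero] at this
    exact (mul_antidiag_eq_zero_iff hl₁).1 this
  have col₅ : ∀ a ∈ Finset.Icc 3 4, block a 5 (g.1 - 1) = 0 := fun a ha => by
    have := hN.mul_eq_zero_of_commutator_left hF h (a := a) (b := 1) 5 (by revert a; decide)
    rw [block_fMatrix_five_one] at this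
    exact eq_zero_of_mul_const_eq_zero hγ₁ this
  have col₆ : ∀ a ∈ Finset.Icc 3 4, block a 6 (g.1 - 1) = 0 := fun a ha => by
    have := hN.mul_eq_zero_of_commutator_left hF h (a := a) (b := 2) 6 (by revert a; decide)
    rw [block_fMatrix_six_two] at this
    exact eq_zero_of_mul_const_eq_zero hγ₂ this
  have hcases : ∀ a b : Fin 8, (a, b) ∉ normalSupport → (a, b) ∉ nilpotentSupport ∨ a = b ∨
      a = 0 ∧ b ∈ Finset.Icc 1 6 ∨ a = 1 ∧ b ∈ Finset.Icc 3 4 ∨ a = 2 ∧ b ∈ Finset.Icc 3 5 ∨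
      b = 7 ∧ a ∈ Finset.Icc 1 6 ∨ b = 5 ∧ a ∈ Finset.Icc 3 4 ∨ b = 6 ∧ a ∈ Finset.Icc 3 4 := by
    decide
  intro a b hab
  rcases hcases a b hab with hab | rfl | ⟨rfl, hb⟩ | ⟨rfl, hb⟩ | ⟨rfl, hb⟩ | ⟨rfl, ha⟩ | ⟨rfl, ha⟩ |
    ⟨rfl, ha⟩
  exacts [hN a b hab, by
    rw [block_sub, block_self_eq_one_of_commutator hl₁ hl₂ h, block_one_self, sub_self],
    row₀ b hb, row₁ b hb, row₂ b hb, col₇ a ha, col₅ a ha, col₆ a ha]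

theorem exists_eq_antidiag_of_commutator (hl₁ : ∀ j, l₁ j ≠ 0)
    (hl₂ : ∀ j : Fin k, (j : ℕ) + 1 < k → l₂ j ≠ 0) (hN : HasBlockSupport normalSupport N)
    (h : (N * fMatrix m k l₁ l₂ γ₁ γ₂ γ₃ - fMatrix m k l₁ l₂ γ₁ γ₂ γ₃ * N).BlockTriangular id) :
    (∃ b : Fin k → ℝ, block 3 4 N = antidiag b) ∧ ∃ d : Fin m → ℝ, block 0 7 N = antidiag d := by
  have hF := hasBlockSupport_fMatrix (l₁ := l₁) (l₂ := l₂) (γ₁ := γ₁) (γ₂ := γ₂) (γ₃ := γ₃)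
  have hdiag := (blockTriangular_iff_block.1 h).2
  have left {a : Fin 8} (c : Fin 8)
      (hc : (∀ d, d ≠ c → (a, d) ∉ normalSupport ∨ (d, a) ∉ fSupport) ∧
        ∀ d, (a, d) ∉ fSupport ∨ (d, a) ∉ normalSupport) :
      (block a c N * block c a (fMatrix m k l₁ l₂ γ₁ γ₂ γ₃)).BlockTriangular id := by
    have := hdiag a
    rwa [block_sub, hN.block_mul_eq_mul hF c hc.1, hF.block_mul_eq_zero hN hc.2, sub_zero] at this
  have right {a : Fin 8} (c : Fin 8)
      (hc : (∀ d, d ≠ c → (a, d) ∉ fSupport ∨ (d, a) ∉ normalSupport) ∧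
        ∀ d, (a, d) ∉ normalSupport ∨ (d, a) ∉ fSupport) :
      (block a c (fMatrix m k l₁ l₂ γ₁ γ₂ γ₃) * block c a N).BlockTriangular id := by
    have := (hdiag a).neg
    rwa [block_sub, hF.block_mul_eq_mul hN c hc.1, hN.block_mul_eq_zero hF hc.2, zero_sub,
      neg_neg] at this
  have h₃ := left (a := 3) 4 (by decide)
  have h₄ := right (a := 4) 3 (by decide)
  have h₀ := left (a := 0) 7 (by decide)
  have h₇ := right (a := 7) 0 (by decide)
  rw [block_fMatrix_four_three] at h₃ h₄
  rw [block_fMatrix_seven_zero] at h₀ h₇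
  exact ⟨exists_eq_antidiag hl₂ h₃ h₄, exists_eq_antidiag (fun j _ => hl₁ j) h₀ h₇⟩

theorem eq_normalForm (hdiag : ∀ a, block a a g.1 = 1)
    (hN : HasBlockSupport normalSupport (g.1 - 1)) :
    g = normalForm (block 1 2 g.1 default default) (block 5 6 g.1 default default)
      (block 1 5 g.1 default default) (block 1 6 g.1 default default)
      (block 2 6 g.1 default default) (block 3 4 g.1) (block 0 7 g.1) := by
  refine eq_unipotent hdiag fun a b hab => ?_
  by_cases h : (a, b) ∈ normalSupport
  · simp only [normalSupport, Finset.mem_insert, Finset.mem_singleton, Prod.mk.injEq] at h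
    rcases h with ⟨rfl, rfl⟩ | ⟨rfl, rfl⟩ | ⟨rfl, rfl⟩ | ⟨rfl, rfl⟩ | ⟨rfl, rfl⟩ | ⟨rfl, rfl⟩ |
      ⟨rfl, rfl⟩
    iterate 5 exact Matrix.ext fun i j => congrArg₂ _ (Unique.eq_default i) (Unique.eq_default j)
    all_goals rfl
  · exact (block_sub_one_of_ne _ hab.ne).symm.trans
      ((hN a b h).trans (normalBlocks_eq_zero _ _ _ _ _ _ _ h).symm)

theorem block_normalForm_mul_fMatrix_of_lt {α β : ℝ} (hαβ : γ₁ * α = γ₂ * β) (p q r : ℝ)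
    (B : Matrix (Fin k) (Fin k) ℝ) (D : Matrix (Fin m) (Fin m) ℝ) {a b : Fin 8} (hba : b < a) :
    block a b (((normalForm α β p q r B D).1 - 1) * fMatrix m k l₁ l₂ γ₁ γ₂ γ₃) =
      block a b (fMatrix m k l₁ l₂ γ₁ γ₂ γ₃ * ((normalForm α β p q r B D).1 - 1)) := by
  have hF := hasBlockSupport_fMatrix (l₁ := l₁) (l₂ := l₂) (γ₁ := γ₁) (γ₂ := γ₂) (γ₃ := γ₃)
  have hN := hasBlockSupport_normalForm_sub_one α β p q r B D
  by_cases hab : a = 5 ∧ b = 2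
  · obtain ⟨rfl, rfl⟩ := hab
    rw [hN.block_mul_eq_mul hF 6 (by decide), hF.block_mul_eq_mul hN 1 (by decide),
      block_sub_one_of_ne _ (by decide), block_sub_one_of_ne _ (by decide),
      block_normalForm_five_six, block_normalForm_one_two, block_fMatrix_six_two,
      block_fMatrix_five_one, const_mul_const, const_mul_const, mul_comm β, hαβ]
  · rw [hN.block_mul_eq_zero hF (by revert a b; decide),
      hF.block_mul_eq_zero hN (by revert a b; decide)]

theorem blockTriangular_commutator_normalForm_self (α β p q r : ℝ) (b : Fin k → ℝ) (d : Fin m → ℝ)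
    (a : Fin 8) :
    (block a a (((normalForm α β p q r (antidiag b) (antidiag d)).1 - 1) *
      fMatrix m k l₁ l₂ γ₁ γ₂ γ₃ - fMatrix m k l₁ l₂ γ₁ γ₂ γ₃ *
        ((normalForm α β p q r (antidiag b) (antidiag d)).1 - 1))).BlockTriangular id := by
  have hF := hasBlockSupport_fMatrix (l₁ := l₁) (l₂ := l₂) (γ₁ := γ₁) (γ₂ := γ₂) (γ₃ := γ₃)
  have hN := hasBlockSupport_normalForm_sub_one α β p q r (antidiag b) (antidiag d)
  have hcases : a = 0 ∨ a = 3 ∨ a = 4 ∨ a = 7 ∨ a ∈ ({1, 2, 5, 6} : Finset (Fin 8)) := by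
    revert a; decide
  rw [block_sub]
  rcases hcases with rfl | rfl | rfl | rfl | ha
  · rw [hN.block_mul_eq_mul hF 7 (by decide), hF.block_mul_eq_zero hN (by decide), sub_zero,
      block_sub_one_of_ne _ (by decide), block_normalForm_zero_seven, block_fMatrix_seven_zero]
    exact blockTriangular_antidiag_mul_antidiag _ _
  · rw [hN.block_mul_eq_mul hF 4 (by decide), hF.block_mul_eq_zero hN (by decide), sub_zero,
      block_sub_one_of_ne _ (by decide), block_normalForm_three_four, block_fMatrix_four_three]
    exact blockTriangular_antidiag_mul_antidiag _ _
  · rw [hN.block_mul_eq_zero hF (by decide), hF.block_mul_eq_mul hN 3 (by decide), zero_sub,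
      block_sub_one_of_ne _ (by decide), block_normalForm_three_four, block_fMatrix_four_three]
    exact (blockTriangular_antidiag_mul_antidiag _ _).neg
  · rw [hN.block_mul_eq_zero hF (by decide), hF.block_mul_eq_mul hN 0 (by decide), zero_sub,
      block_sub_one_of_ne _ (by decide), block_normalForm_zero_seven, block_fMatrix_seven_zero]
    exact (blockTriangular_antidiag_mul_antidiag _ _).neg
  · simp only [Finset.mem_insert, Finset.mem_singleton] at ha
    rcases ha with rfl | rfl | rfl | rfl <;> exact blockTriangular_of_subsingleton _

theorem normalForm_mem_coadjStabilizer {α β : ℝ} (hαβ : γ₁ * α = γ₂ * β) (p q r : ℝ)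
    (b : Fin k → ℝ) (d : Fin m → ℝ) : normalForm α β p q r (antidiag b) (antidiag d) ∈
      coadjStabilizer (traceDual (fMatrix m k l₁ l₂ γ₁ γ₂ γ₃)) :=
  (mem_coadjStabilizer_iff _ _).2 <| blockTriangular_iff_block.2
    ⟨fun a c hca => by
      rw [block_sub, block_normalForm_mul_fMatrix_of_lt hαβ p q r _ _ hca, sub_self],
    blockTriangular_commutator_normalForm_self α β p q r b d⟩

theorem exists_eq_normalForm_of_mem_coadjStabilizer (hl₁ : ∀ j, l₁ j ≠ 0)
    (hl₂ : ∀ j : Fin k, (j : ℕ) + 1 < k → l₂ j ≠ 0) (hγ₁ : γ₁ ≠ 0) (hγ₂ : γ₂ ≠ 0)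
    (h : g ∈ coadjStabilizer (traceDual (fMatrix m k l₁ l₂ γ₁ γ₂ γ₃))) :
    ∃ α β p q r b d, γ₁ * α = γ₂ * β ∧ g = normalForm α β p q r (antidiag b) (antidiag d) := by
  rw [mem_coadjStabilizer_iff] at h
  have hN := hasBlockSupport_normalSupport hl₁ hl₂ hγ₁ hγ₂ h
  have hF := hasBlockSupport_fMatrix (l₁ := l₁) (l₂ := l₂) (γ₁ := γ₁) (γ₂ := γ₂) (γ₃ := γ₃)
  obtain ⟨⟨b, hb⟩, d, hd⟩ := exists_eq_antidiag_of_commutator hl₁ hl₂ hN h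
  rw [block_sub_one_of_ne _ (by decide)] at hb hd
  have hg := eq_normalForm (block_self_eq_one_of_commutator hl₁ hl₂ h) hN
  rw [hb, hd] at hg
  have h₅₂ := hN.mul_eq_mul_of_commutator hF h (a := 5) (b := 2) 6 1 (by decide) (by decide)
    (by decide)
  rw [block_sub_one_of_ne _ (by decide), block_sub_one_of_ne _ (by decide),
    block_fMatrix_six_two, block_fMatrix_five_one] at h₅₂
  refine ⟨_, _, _, _, _, b, d, ?_, hg⟩
  simpa [Matrix.mul_apply, mul_comm γ₂] using (congrFun₂ h₅₂ default default).symm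

end Stabilizer

/-! ### The zero set of `I'` -/

section ZeroSet

theorem evalAt_genMatrix {n : ℕ} (g : UT n) (i j : Fin n) :
    evalAt g (genMatrix n i j) = g.1 i j := by
  simp only [genMatrix, Matrix.of_apply]
  split_ifs with h h'
  · exact MvPolynomial.eval_X _
  · rw [map_one, h', g.2.1]
  · rw [map_zero, g.2.2 i j (lt_of_le_of_ne (not_lt.1 h) (Ne.symm h'))]

theorem evalAt_det_submatrix {n : ℕ} (g : UT n) {ι : Type*} [Fintype ι] [DecidableEq ι]
    (r c : ι → Fin n) :
    evalAt g ((genMatrix n).submatrix r c).det = (g.1.submatrix r c).det := by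
  rw [RingHom.map_det]
  congr 1
  ext i j
  exact evalAt_genMatrix g _ _

variable {m k : ℕ}

/-- The matrix of the minor `Δ(c)` of an entry `c` of the block at place `(a, b)` of `P`. -/
def minorMatrix (a b : Fin 8) (P : PartitionedMatrix m k) :
    Matrix (MinorIndex m k a b) (MinorIndex m k a b) ℝ :=
  P.submatrix (minorRow m k a b) (minorCol m k a b)

/-- The matrix of the minor of `P` obtained from `Δ(c)` by adding the row and the column of `c`,
where `c` is the entry number `(i, j)` of the block at place `(a, b)`. As in `signedDeltaTilde`, the
added row and column have the index `none`. -/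
def borderedMatrix (a b : Fin 8) (i : Fin (blockSize m k a)) (j : Fin (blockSize m k b))
    (P : PartitionedMatrix m k) :
    Matrix (Option (MinorIndex m k a b)) (Option (MinorIndex m k a b)) ℝ :=
  P.submatrix (fun x => x.elim (pos m k a i) (minorRow m k a b))
    (fun x => x.elim (pos m k b j) (minorCol m k a b))

theorem minorMatrix_sub_one (a b : Fin 8) (P : PartitionedMatrix m k) :
    minorMatrix a b (P - 1) = minorMatrix a b P := by
  have hPhi : ∀ p ∈ Phi, ∀ q ∈ Phi, p.1 ≠ q.2 := by decide
  ext x y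
  exact (congrArg _ (Matrix.one_apply_ne (pos_ne_pos (hPhi _ x.1.2.1 _ y.1.2.1) _ _))).trans
    (sub_zero _)

theorem borderedMatrix_sub_one {a b : Fin 8} (hab : a ≠ b)
    (i : Fin (blockSize m k a)) (j : Fin (blockSize m k b)) (P : PartitionedMatrix m k) :
    borderedMatrix a b i j (P - 1) = borderedMatrix a b i j P := by
  have hlt : ∀ p ∈ Phi, p.1 < p.2 := by decide
  have hne : ∀ p ∈ Phi, ∀ q ∈ Phi, p.1 ≠ q.2 := by decide
  ext x y
  refine (congrArg _ (Matrix.one_apply_ne ?_)).trans (sub_zero _)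
  rcases x with _ | ⟨⟨p, hp, hap, hpb⟩, x⟩ <;> rcases y with _ | ⟨⟨q, hq, haq, hqb⟩, y⟩
  · exact pos_ne_pos hab _ _
  · exact pos_ne_pos (haq.trans (hlt q hq)).ne _ _
  · exact pos_ne_pos ((hlt p hp).trans hpb).ne _ _
  · exact pos_ne_pos (hne p hp q hq) _ _

theorem evalAt_blockC (g : UT (matSize m k)) (a b : Fin 8) (i j) :
    evalAt g (blockC m k a b i j) = block a b g.1 i j :=
  evalAt_genMatrix g _ _

theorem evalAt_det23 (g : UT (matSize m k)) :
    evalAt g (det23 m k) = block 1 2 g.1 default default :=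
  (congrArg (evalAt g) (Matrix.det_unique (n := Fin 1) _)).trans (evalAt_blockC g 1 2 _ _)

theorem evalAt_det67 (g : UT (matSize m k)) :
    evalAt g (det67 m k) = block 5 6 g.1 default default :=
  (congrArg (evalAt g) (Matrix.det_unique (n := Fin 1) _)).trans (evalAt_blockC g 5 6 _ _)

theorem evalAt_det45 (g : UT (matSize m k)) :
    evalAt g (det45 m k) = Matrix.det (n := Fin k) (block 3 4 g.1) :=
  evalAt_det_submatrix (ι := Fin k) g _ _

theorem evalAt_denom_ne_zero_iff (g : UT (matSize m k)) :
    evalAt g (denom m k) ≠ 0 ↔ block 1 2 g.1 default default ≠ 0 ∧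
      Matrix.det (n := Fin k) (block 3 4 g.1) ≠ 0 ∧ block 5 6 g.1 default default ≠ 0 := by
  rw [denom, map_mul, map_mul, evalAt_det23, evalAt_det45, evalAt_det67, mul_ne_zero_iff,
    mul_ne_zero_iff, and_assoc]

theorem evalLoc_algebraMap (g : UT (matSize m k)) (hg : evalAt g (denom m k) ≠ 0)
    (x : CoordRing (matSize m k)) :
    evalLoc m k g hg (algebraMap _ (LocRing m k) x) = evalAt g x :=
  IsLocalization.Away.lift_eq _ _ x

theorem evalLoc_cTilde_eq_zero_iff (g : UT (matSize m k)) (hg : evalAt g (denom m k) ≠ 0)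
    (a b : Fin 8) (i : Fin (blockSize m k a)) (j : Fin (blockSize m k b)) :
    evalLoc m k g hg (cTilde m k a b i j) = 0 ↔ (borderedMatrix a b i j g.1).det = 0 := by
  have hu := ((Delta_isUnit m k a b).ringInverse).map (evalLoc m k g hg)
  rw [cTilde, map_mul, mul_eq_zero, or_iff_right hu.ne_zero, evalLoc_algebraMap,
    signedDeltaTilde, evalAt_det_submatrix]
  rfl

theorem mem_zeroSet_span_iff (S : Set (LocRing m k)) (g : UT (matSize m k)) :
    g ∈ zeroSet m k (Ideal.span S) ↔
      ∃ hg : evalAt g (denom m k) ≠ 0, ∀ φ ∈ S, evalLoc m k g hg φ = 0 :=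
  exists_congr fun hg => Ideal.span_le (I := RingHom.ker (evalLoc m k g hg))

/-- The places above the diagonal. -/
def strictSupport : Finset (Fin 8 × Fin 8) :=
  Finset.univ.filter fun p => p.1 < p.2

/-- The conditions on `V = g - 1` that cut out the zero set of `I'`: the first four say that the
generators in `S₀` vanish at `g` and that `d(g) ≠ 0`, the others that the generators in `S₁` and
`S₂` vanish. The blocks of `V * V` at places `(2, 5)` and `(4, 7)` (counted from one) are the
values of `C₂₃ C₃₅ + C₂₄ C₄₅` and `C₄₅ C₅₇ + C₄₆ C₆₇`. -/
structure VanishingConditions (γ₁ γ₂ : ℝ) (V : PartitionedMatrix m k) : Prop where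
  hasBlockSupport : HasBlockSupport strictSupport V
  one_two_ne_zero : block 1 2 V default default ≠ 0
  det_three_four_ne_zero : Matrix.det (n := Fin k) (block 3 4 V) ≠ 0
  five_six_ne_zero : block 5 6 V default default ≠ 0
  det_bordered : ∀ p ∈ bulletBlocks, ∀ i j, (borderedMatrix p.1 p.2 i j V).det = 0
  sq_one_four : block 1 4 (V * V) = 0
  sq_three_six : block 3 6 (V * V) = 0
  scalar : γ₁ * block 1 2 V default default = γ₂ * block 5 6 V default default

theorem evalLoc_S0_eq_zero_iff (g : UT (matSize m k)) (hg : evalAt g (denom m k) ≠ 0) :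
    (∀ φ ∈ S0 m k, evalLoc m k g hg φ = 0) ↔ HasBlockSupport strictSupport (g.1 - 1) := by
  constructor
  · intro h a b hab
    by_cases hN : (a, b) ∈ nilpotentSupport
    swap
    · exact hasBlockSupport_sub_one g a b hN
    obtain ⟨rfl, ha⟩ : a = b ∧ a ∈ ({0, 3, 4, 7} : Finset (Fin 8)) := by
      revert a b; decide
    rw [block_sub, block_one_self, sub_eq_zero]
    refine UT.eq_one (block_self_mem_UT g a) fun i j hij => ?_
    rw [← evalAt_blockC, ← evalLoc_algebraMap g hg]
    exact h _ ⟨a, ha, i, j, hij, rfl⟩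
  · rintro h _ ⟨a, -, i, j, hij, rfl⟩
    have ha := h a a (by simp [strictSupport])
    rw [block_sub, block_one_self, sub_eq_zero] at ha
    rw [evalLoc_algebraMap, evalAt_blockC, ha, Matrix.one_apply_ne hij.ne]

theorem evalLoc_S1_eq_zero_iff (g : UT (matSize m k)) (hg : evalAt g (denom m k) ≠ 0) :
    (∀ φ ∈ S1 m k, evalLoc m k g hg φ = 0) ↔
      ∀ p ∈ bulletBlocks, ∀ i j, (borderedMatrix p.1 p.2 i j (g.1 - 1)).det = 0 := by
  have hne : ∀ p ∈ bulletBlocks, p.1 ≠ p.2 := by decide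
  constructor
  · intro h p hp i j
    rw [borderedMatrix_sub_one (hne p hp), ← evalLoc_cTilde_eq_zero_iff g hg]
    exact h _ ⟨p, hp, i, j, rfl⟩
  · rintro h _ ⟨p, hp, i, j, rfl⟩
    rw [evalLoc_cTilde_eq_zero_iff, ← borderedMatrix_sub_one (hne p hp)]
    exact h p hp i j

theorem HasBlockSupport.block_mul_self_one_four {V : PartitionedMatrix m k}
    (hV : HasBlockSupport strictSupport V) :
    block 1 4 (V * V) = block 1 2 V * block 2 4 V + block 1 3 V * block 3 4 V :=
  hV.block_mul_eq_add hV 2 3 (by decide) (by decide)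

theorem HasBlockSupport.block_mul_self_three_six {V : PartitionedMatrix m k}
    (hV : HasBlockSupport strictSupport V) :
    block 3 6 (V * V) = block 3 4 V * block 4 6 V + block 3 5 V * block 5 6 V :=
  hV.block_mul_eq_add hV 4 5 (by decide) (by decide)

theorem evalAt_blockC_mul_add (g : UT (matSize m k)) (a b c d : Fin 8) :
    (∀ i j, evalAt g ((blockC m k a b * blockC m k b d + blockC m k a c * blockC m k c d) i j) = 0)
      ↔ block a b g.1 * block b d g.1 + block a c g.1 * block c d g.1 = 0 := by
  rw [← Matrix.ext_iff]
  simp only [Matrix.add_apply, Matrix.mul_apply, map_add, map_sum, map_mul, evalAt_blockC,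
    Matrix.zero_apply]

theorem evalLoc_S2_eq_zero_iff (γ₁ γ₂ : ℝ) (g : UT (matSize m k)) (hg : evalAt g (denom m k) ≠ 0) :
    (∀ φ ∈ S2 m k γ₁ γ₂, evalLoc m k g hg φ = 0) ↔
      block 1 2 g.1 * block 2 4 g.1 + block 1 3 g.1 * block 3 4 g.1 = 0 ∧
      block 3 4 g.1 * block 4 6 g.1 + block 3 5 g.1 * block 5 6 g.1 = 0 ∧
      γ₁ * block 1 2 g.1 default default = γ₂ * block 5 6 g.1 default default := by
  have hscalar : evalAt g (MvPolynomial.C γ₁ * det23 m k - MvPolynomial.C γ₂ * det67 m k) =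
      γ₁ * block 1 2 g.1 default default - γ₂ * block 5 6 g.1 default default := by
    rw [map_sub, map_mul, map_mul, evalAt_det23, evalAt_det67]
    simp [evalAt]
  rw [← evalAt_blockC_mul_add, ← evalAt_blockC_mul_add, ← sub_eq_zero (b := γ₂ * _), ← hscalar]
  simp only [← evalLoc_algebraMap g hg]
  constructor
  · exact fun h => ⟨fun i j => h _ (.inl (.inl ⟨i, j, rfl⟩)),
      fun i j => h _ (.inl (.inr ⟨i, j, rfl⟩)), h _ (.inr rfl)⟩
  · rintro ⟨h₁, h₂, h₃⟩ _ ((⟨i, j, rfl⟩ | ⟨i, j, rfl⟩) | rfl)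
    exacts [h₁ i j, h₂ i j, h₃]

theorem mem_zeroSet_idealI'_iff (γ₁ γ₂ : ℝ) (g : UT (matSize m k)) :
    g ∈ zeroSet m k (idealI' m k γ₁ γ₂) ↔ VanishingConditions γ₁ γ₂ (g.1 - 1) := by
  have hblock (a b : Fin 8) (h : a ≠ b) : block a b g.1 = block a b (g.1 - 1) :=
    (block_sub_one_of_ne g.1 h).symm
  rw [idealI', mem_zeroSet_span_iff]
  simp only [Set.mem_union, or_imp, forall_and, evalLoc_S0_eq_zero_iff, evalLoc_S1_eq_zero_iff,
    evalLoc_S2_eq_zero_iff, exists_prop, evalAt_denom_ne_zero_iff, hblock 1 2 (by decide),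
    hblock 1 3 (by decide), hblock 2 4 (by decide), hblock 3 4 (by decide),
    hblock 3 5 (by decide), hblock 4 6 (by decide), hblock 5 6 (by decide)]
  constructor
  · rintro ⟨⟨h₁₂, h₃₄, h₅₆⟩, ⟨h₀, h₁⟩, h₁₄, h₃₆, hγ⟩
    exact ⟨h₀, h₁₂, h₃₄, h₅₆, h₁, h₀.block_mul_self_one_four.trans h₁₄,
      h₀.block_mul_self_three_six.trans h₃₆, hγ⟩
  · rintro ⟨h₀, h₁₂, h₃₄, h₅₆, h₁, h₁₄, h₃₆, hγ⟩
    exact ⟨⟨h₁₂, h₃₄, h₅₆⟩, ⟨h₀, h₁⟩, h₀.block_mul_self_one_four.symm.trans h₁₄,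
      h₀.block_mul_self_three_six.symm.trans h₃₆, hγ⟩

theorem VanishingConditions.det_minorMatrix_ne_zero {γ₁ γ₂ : ℝ} {g : UT (matSize m k)}
    (h : VanishingConditions γ₁ γ₂ (g.1 - 1)) (a b : Fin 8) :
    (minorMatrix a b (g.1 - 1)).det ≠ 0 := by
  obtain ⟨hg, -⟩ := (mem_zeroSet_idealI'_iff γ₁ γ₂ g).2 h
  have hΔ := (Delta_isUnit m k a b).map (evalLoc m k g hg)
  rw [evalLoc_algebraMap, Delta, evalAt_det_submatrix] at hΔ
  rw [minorMatrix_sub_one]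
  exact hΔ.ne_zero

end ZeroSet

/-! ### Reduction to the normal form -/

section Schur

theorem add_sum_mul_eq_zero_of_det_eq_zero {K ι : Type*} [Field K] [Fintype ι] [DecidableEq ι]
    {N : Matrix (Option ι) (Option ι) K} (hN : N.det = 0)
    (hminor : (N.submatrix some some).det ≠ 0) {w : ι → K}
    (hw : ∀ y, N none (some y) + ∑ x, w x * N (some x) (some y) = 0) :
    N none none + ∑ x, w x * N (some x) none = 0 := by
  obtain ⟨v, hv, hNv⟩ := Matrix.exists_mulVec_eq_zero_iff.2 hN
  have hdot : (N none none + ∑ x, w x * N (some x) none) * v none = 0 := by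
    have hcomb : (fun x : Option ι => x.elim 1 w) ⬝ᵥ N.mulVec v = 0 := by rw [hNv, dotProduct_zero]
    rw [Matrix.dotProduct_mulVec, dotProduct, Fintype.sum_option] at hcomb
    simpa only [Matrix.vecMul, dotProduct, Fintype.sum_option, Option.elim_none, Option.elim_some,
      one_mul, hw, zero_mul, Finset.sum_const_zero, add_zero] using hcomb
  refine (mul_eq_zero.1 hdot).resolve_right fun hnone => hv ?_
  have hsome : (fun x => v (some x)) = 0 := by
    refine Matrix.eq_zero_of_mulVec_eq_zero hminor (funext fun x => ?_)
    simpa [Matrix.mulVec, dotProduct, Fintype.sum_option, hnone] using congrFun hNv (some x)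
  funext x
  rcases x with _ | x
  exacts [hnone, congrFun hsome x]

variable {m k : ℕ}

theorem block_mul_eq_zero_of_det_borderedMatrix {V L : PartitionedMatrix m k} {a b : Fin 8}
    (hminor : (minorMatrix a b V).det ≠ 0) (hdet : ∀ i j, (borderedMatrix a b i j V).det = 0)
    (hmul : ∀ y, (y = b ∨ ∃ p ∈ Phi, a < p.1 ∧ p.2 < b ∧ p.2 = y) → block a y (L * V) =
      block a y V + ∑ p ∈ Phi with a < p.1 ∧ p.2 < b, block a p.1 L * block p.1 y V)
    (hpivot : ∀ p ∈ Phi, a < p.1 → p.2 < b → block a p.2 (L * V) = 0) :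
    block a b (L * V) = 0 := by
  have hentry : ∀ y, (y = b ∨ ∃ p ∈ Phi, a < p.1 ∧ p.2 < b ∧ p.2 = y) → ∀ i j,
      block a y (L * V) i j = V (pos m k a i) (pos m k y j) + ∑ x : MinorIndex m k a b,
        L (pos m k a i) (minorRow m k a b x) * V (minorRow m k a b x) (pos m k y j) := by
    intro y hy i j
    rw [hmul y hy, Matrix.add_apply, Matrix.sum_apply, Fintype.sum_sigma,
      Finset.sum_subtype (p := fun p => p ∈ Phi ∧ a < p.1 ∧ p.2 < b) _
        (fun _ => Finset.mem_filter)]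
    rfl
  ext i j
  rw [hentry b (.inl rfl)]
  refine add_sum_mul_eq_zero_of_det_eq_zero (hdet i j) hminor fun ⟨⟨p, hp, hap, hpb⟩, y⟩ => ?_
  exact (hentry p.2 (.inr ⟨p, hp, hap, hpb, rfl⟩) i _).symm.trans
    (congrFun (congrFun (hpivot p hp hap hpb) i) _)

end Schur

section Reduction

variable {m k : ℕ} {γ₁ γ₂ : ℝ}

/-- The places where the element that conjugates into normal form may have nonzero blocks. -/
def reductionSupport : Finset (Fin 8 × Fin 8) :=
  Finset.univ.filter (fun p => p.1 = p.2) ∪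
    {(0, 1), (0, 3), (0, 5), (1, 3), (2, 3), (2, 5), (2, 6), (2, 7), (4, 5), (4, 6), (4, 7), (6, 7)}

/-- The places outside the distinguished blocks at which the first stage of the elimination
produces zeros. -/
def pivotPlaces : Finset (Fin 8 × Fin 8) :=
  {(0, 2), (0, 4), (0, 6), (1, 4), (2, 4), (2, 6), (4, 6)}

/-- `L` conjugates `1 + V` into normal form: the rows `0`, `2`, `4` of `L * V` are cleared by row
operations, and the rows `1`, `3`, `5` of `L * V` are multiples of the rows `2`, `4`, `6` of `L`,
up to the block at place `(1, 5)`. -/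
structure IsReducing (V : PartitionedMatrix m k) (L : UT (matSize m k)) : Prop where
  block_self : ∀ a, block a a L.1 = 1
  hasBlockSupport : HasBlockSupport reductionSupport L.1
  pivot : ∀ p ∈ pivotPlaces, block p.1 p.2 (L.1 * V) = 0
  block_mul : ∀ p ∈ Phi, ∀ b, p.2 < b → (p.1, b) ≠ (1, 5) →
    block p.1 b (L.1 * V) = block p.1 p.2 V * block p.2 b L.1

/-- The blocks above the diagonal of an element as in `IsReducing`; here `A`, `B`, `C` are the
inverses of the blocks of `V` at the places in `Phi`. -/
def reductionBlocks (V : PartitionedMatrix m k) (A : Block m k 2 1) (B : Block m k 4 3)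
    (C : Block m k 6 5) (a b : Fin 8) : Block m k a b :=
  let h01 := -(block 0 2 V * A)
  let h03 := -((block 0 4 V + h01 * block 1 4 V) * B)
  let h05 := -((block 0 6 V + h01 * block 1 6 V + h03 * block 3 6 V) * C)
  let h13 := -(block 1 4 V * B)
  let h23 := A * block 1 3 V
  let h25 := -((block 2 6 V + h23 * block 3 6 V) * C)
  match a, b with
  | 0, 1 => h01
  | 0, 3 => h03
  | 0, 5 => h05
  | 1, 3 => h13
  | 2, 3 => h23
  | 2, 5 => h25
  | 2, 6 => A * (block 1 6 V + h13 * block 3 6 V)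
  | 2, 7 => A * (block 1 7 V + h13 * block 3 7 V)
  | 4, 5 => B * block 3 5 V
  | 4, 6 => B * block 3 6 V
  | 4, 7 => B * block 3 7 V
  | 6, 7 => C * block 5 7 V
  | _, _ => 0

theorem hasBlockSupport_unipotent_reductionBlocks (V : PartitionedMatrix m k) (A : Block m k 2 1)
    (B : Block m k 4 3) (C : Block m k 6 5) :
    HasBlockSupport reductionSupport (unipotent (reductionBlocks V A B C)).1 := by
  intro a b h
  rcases lt_trichotomy a b with hab | rfl | hab
  · rw [block_unipotent_of_lt _ hab]
    fin_cases a <;> fin_cases b <;> first | rfl | exact absurd (by decide) h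
  · exact absurd (by simp [reductionSupport]) h
  · exact block_eq_zero_of_lt _ hab

theorem add_neg_mul_mul_eq_zero {l n o R : Type*} [Fintype n] [Fintype o] [DecidableEq o] [Ring R]
    {X : Matrix n o R} {Y : Matrix o n R} (hXY : Y * X = 1) (Z : Matrix l o R) :
    Z + -(Z * Y) * X = 0 := by
  rw [Matrix.neg_mul, Matrix.mul_assoc, hXY, Matrix.mul_one, add_neg_cancel]

theorem add_mul_mul_eq_zero {l n o p R : Type*} [Fintype l] [Fintype n] [Fintype o] [DecidableEq n]
    [Ring R] {A : Matrix n l R} {X : Matrix l n R} {Y : Matrix l o R} {Z : Matrix n p R}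
    {W : Matrix o p R} (hA : A * X = 1) (h : X * Z + Y * W = 0) : Z + A * Y * W = 0 := by
  rw [Matrix.mul_assoc, eq_neg_of_add_eq_zero_right h, Matrix.mul_neg, ← Matrix.mul_assoc, hA,
    Matrix.one_mul, add_neg_cancel]

theorem eq_mul_mul_of_mul_eq_one {n o p R : Type*} [Fintype n] [Fintype o] [DecidableEq n] [Ring R]
    {X : Matrix n o R} {Y : Matrix o n R} (h : X * Y = 1) (Z : Matrix n p R) :
    Z = X * (Y * Z) := by
  rw [← Matrix.mul_assoc, h, Matrix.one_mul]

section

variable {V : PartitionedMatrix m k} {A : Block m k 2 1} {B : Block m k 4 3} {C : Block m k 6 5}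

theorem VanishingConditions.block_unipotent_reductionBlocks_mul_eq_zero
    (hV : VanishingConditions γ₁ γ₂ V) (hA : A * block 1 2 V = (1 : Block m k 2 2))
    (hB : B * block 3 4 V = (1 : Block m k 4 4)) (hC : C * block 5 6 V = (1 : Block m k 6 6))
    {p : Fin 8 × Fin 8} (hp : p ∈ pivotPlaces) :
    block p.1 p.2 ((unipotent (reductionBlocks V A B C)).1 * V) = 0 := by
  have h₁₄ := hV.hasBlockSupport.block_mul_self_one_four ▸ hV.sq_one_four
  have h₃₆ := hV.hasBlockSupport.block_mul_self_three_six ▸ hV.sq_three_six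
  have hS := hasBlockSupport_unipotent_reductionBlocks V A B C
  have hself := block_unipotent_self (reductionBlocks V A B C)
  have hblock {a b} (hab : a < b) := block_unipotent_of_lt (reductionBlocks V A B C) hab
  simp only [pivotPlaces, Finset.mem_insert, Finset.mem_singleton] at hp
  rcases hp with rfl | rfl | rfl | rfl | rfl | rfl | rfl
  · rw [hS.block_mul_eq_sum hV.hasBlockSupport {0, 1} (by decide), Finset.sum_pair (by decide),
      hself, Matrix.one_mul, hblock (by decide)]
    exact add_neg_mul_mul_eq_zero hA _
  · rw [hS.block_mul_eq_sum hV.hasBlockSupport {0, 1, 3} (by decide),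
      Finset.sum_insert (by decide), Finset.sum_pair (by decide), ← add_assoc, hself,
      Matrix.one_mul, hblock (by decide), hblock (by decide)]
    exact add_neg_mul_mul_eq_zero hB _
  · rw [hS.block_mul_eq_sum hV.hasBlockSupport {0, 1, 3, 5} (by decide),
      Finset.sum_insert (by decide), Finset.sum_insert (by decide), Finset.sum_pair (by decide),
      ← add_assoc, ← add_assoc, hself, Matrix.one_mul, hblock (by decide), hblock (by decide),
      hblock (by decide)]
    exact add_neg_mul_mul_eq_zero hC _
  · rw [hS.block_mul_eq_sum hV.hasBlockSupport {1, 3} (by decide), Finset.sum_pair (by decide),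
      hself, Matrix.one_mul, hblock (by decide)]
    exact add_neg_mul_mul_eq_zero hB _
  · rw [hS.block_mul_eq_sum hV.hasBlockSupport {2, 3} (by decide), Finset.sum_pair (by decide),
      hself, Matrix.one_mul, hblock (by decide)]
    exact add_mul_mul_eq_zero hA h₁₄
  · rw [hS.block_mul_eq_sum hV.hasBlockSupport {2, 3, 5} (by decide),
      Finset.sum_insert (by decide), Finset.sum_pair (by decide), ← add_assoc, hself,
      Matrix.one_mul, hblock (by decide), hblock (by decide)]
    exact add_neg_mul_mul_eq_zero hC _
  · rw [hS.block_mul_eq_sum hV.hasBlockSupport {4, 5} (by decide), Finset.sum_pair (by decide),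
      hself, Matrix.one_mul, hblock (by decide)]
    exact add_mul_mul_eq_zero hB h₃₆

theorem VanishingConditions.block_unipotent_reductionBlocks_mul
    (hV : VanishingConditions γ₁ γ₂ V) (hA : block 1 2 V * A = (1 : Block m k 1 1))
    (hB : block 3 4 V * B = (1 : Block m k 3 3)) (hC : block 5 6 V * C = (1 : Block m k 5 5))
    {p : Fin 8 × Fin 8} (hp : p ∈ Phi) {b : Fin 8} (hb : p.2 < b) (hpb : (p.1, b) ≠ (1, 5))
    (h₁₄ : block 1 4 ((unipotent (reductionBlocks V A B C)).1 * V) = 0) :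
    block p.1 b ((unipotent (reductionBlocks V A B C)).1 * V) =
      block p.1 p.2 V * block p.2 b (unipotent (reductionBlocks V A B C)).1 := by
  have hS := hasBlockSupport_unipotent_reductionBlocks V A B C
  have hself := block_unipotent_self (reductionBlocks V A B C)
  rw [block_unipotent_of_lt _ hb]
  simp only [Phi, Finset.mem_insert, Finset.mem_singleton] at hp
  rcases hp with rfl | rfl | rfl
  · obtain rfl | rfl | ⟨hb', h⟩ : b = 3 ∨ b = 4 ∨ 6 ≤ b ∧
        ∀ c ∉ ({1, 3} : Finset (Fin 8)), (1, c) ∉ reductionSupport ∨ (c, b) ∉ strictSupport := by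
      revert b; decide
    · rw [hS.block_mul_eq_mul hV.hasBlockSupport 1 (by decide), hself, Matrix.one_mul]
      exact eq_mul_mul_of_mul_eq_one hA _
    · exact h₁₄.trans (Matrix.mul_zero _).symm
    · rw [hS.block_mul_eq_sum hV.hasBlockSupport {1, 3} h, Finset.sum_pair (by decide), hself,
        Matrix.one_mul, block_unipotent_of_lt _ (by decide)]
      obtain rfl | rfl : b = 6 ∨ b = 7 := by clear h hb hpb; revert b; decide
      all_goals exact eq_mul_mul_of_mul_eq_one hA _
  · rw [hS.block_mul_eq_mul hV.hasBlockSupport 3 (by clear hb hpb; revert b; decide), hself,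
      Matrix.one_mul]
    obtain rfl | rfl | rfl : b = 5 ∨ b = 6 ∨ b = 7 := by clear hpb; revert b; decide
    all_goals exact eq_mul_mul_of_mul_eq_one hB _
  · rw [hS.block_mul_eq_mul hV.hasBlockSupport 5 (by clear hb hpb; revert b; decide), hself,
      Matrix.one_mul]
    obtain rfl : b = 7 := by clear hpb; revert b; decide
    exact eq_mul_mul_of_mul_eq_one hC _

theorem exists_inverse_of_det_ne_zero {s t : ℕ} (h : s = t) {X : Matrix (Fin s) (Fin t) ℝ}
    (hX : (X.submatrix id (Fin.cast h)).det ≠ 0) :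
    ∃ Y : Matrix (Fin t) (Fin s) ℝ, X * Y = 1 ∧ Y * X = 1 := by
  subst h
  have hX := isUnit_iff_ne_zero.2 hX
  exact ⟨X⁻¹, Matrix.mul_nonsing_inv X hX, Matrix.nonsing_inv_mul X hX⟩

theorem VanishingConditions.exists_isReducing
    (hV : VanishingConditions γ₁ γ₂ V) : ∃ L, IsReducing V L := by
  obtain ⟨A, hA, hA'⟩ := exists_inverse_of_det_ne_zero rfl (X := block 1 2 V)
    ((Matrix.det_unique (n := Fin 1) _).trans_ne hV.one_two_ne_zero)
  obtain ⟨B, hB, hB'⟩ := exists_inverse_of_det_ne_zero rfl (X := block 3 4 V)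
    hV.det_three_four_ne_zero
  obtain ⟨C, hC, hC'⟩ := exists_inverse_of_det_ne_zero rfl (X := block 5 6 V)
    ((Matrix.det_unique (n := Fin 1) _).trans_ne hV.five_six_ne_zero)
  have hpivot {p} (hp : p ∈ pivotPlaces) :=
    hV.block_unipotent_reductionBlocks_mul_eq_zero hA' hB' hC' hp
  exact ⟨_, block_unipotent_self _, hasBlockSupport_unipotent_reductionBlocks V A B C,
    fun _ => hpivot, fun _ hp _ hb hpb => hV.block_unipotent_reductionBlocks_mul hA hB hC hp hb hpb
      (hpivot (p := (1, 4)) (by decide))⟩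

end

variable {V : PartitionedMatrix m k} {L : UT (matSize m k)}

theorem VanishingConditions.block_six_seven (hV : VanishingConditions γ₁ γ₂ V)
    (hminor : ∀ a b, (minorMatrix a b V).det ≠ 0) : block 6 7 V = 0 := by
  have hempty : Phi.filter (fun p => (6 : Fin 8) < p.1 ∧ p.2 < 7) = ∅ := by decide
  rw [← Matrix.one_mul V]
  refine block_mul_eq_zero_of_det_borderedMatrix (hminor 6 7)
    (hV.det_bordered (6, 7) (by decide)) (fun y _ => ?_)
    fun p hp h => absurd h (by revert p; decide)
  rw [hempty, Finset.sum_empty, add_zero, Matrix.one_mul]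

theorem IsReducing.block_mul_eq_add_sum (hL : IsReducing V L)
    (hV : VanishingConditions γ₁ γ₂ V) (h₆₇ : block 6 7 V = 0) {p : Fin 8 × Fin 8}
    (hp : p ∈ bulletBlocks) {y : Fin 8}
    (hy : y = p.2 ∨ ∃ q ∈ Phi, p.1 < q.1 ∧ q.2 < p.2 ∧ q.2 = y) :
    block p.1 y (L.1 * V) = block p.1 y V +
      ∑ q ∈ Phi with p.1 < q.1 ∧ q.2 < p.2, block p.1 q.1 L.1 * block q.1 y V := by
  have hS : HasBlockSupport (strictSupport.erase (6, 7)) V := by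
    intro a b h
    by_cases h' : (a, b) = (6, 7)
    · obtain ⟨rfl, rfl⟩ := Prod.mk.inj h'
      exact h₆₇
    · exact hV.hasBlockSupport a b fun hab => h (Finset.mem_erase.2 ⟨h', hab⟩)
  have hPhi : ∀ q ∈ Phi, ∀ q' ∈ Phi, q.1 = q'.1 → q = q' := by decide
  have hinj : Set.InjOn Prod.fst
      (Phi.filter fun q => p.1 < q.1 ∧ q.2 < p.2 : Set (Fin 8 × Fin 8)) := fun q hq q' hq' =>
    hPhi q (Finset.mem_filter.1 hq).1 q' (Finset.mem_filter.1 hq').1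
  have hsupp : ∀ c ∉ insert p.1 ((Phi.filter fun q => p.1 < q.1 ∧ q.2 < p.2).image Prod.fst),
      (p.1, c) ∉ reductionSupport ∨ (c, y) ∉ strictSupport.erase (6, 7) := by
    clear hinj
    simp only [bulletBlocks, Finset.mem_insert, Finset.mem_singleton] at hp
    rcases hp with rfl | rfl | rfl | rfl | rfl | rfl | rfl | rfl | rfl <;> revert y <;> decide
  rw [hL.hasBlockSupport.block_mul_eq_sum hS _ hsupp, Finset.sum_insert (by simp +contextual),
    Finset.sum_image hinj, hL.block_self, Matrix.one_mul]

theorem IsReducing.block_mul_eq_zero (hL : IsReducing V L) (hV : VanishingConditions γ₁ γ₂ V)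
    (hminor : ∀ a b, (minorMatrix a b V).det ≠ 0) {a b : Fin 8}
    (ha : a ∈ ({0, 2, 4, 6} : Finset (Fin 8))) (hab : (a, b) ≠ (0, 7)) :
    block a b (L.1 * V) = 0 := by
  obtain hpivot | hbullet | hlower : (a, b) ∈ pivotPlaces ∨ (a, b) ∈ bulletBlocks ∨
      ∀ c, (a, c) ∉ reductionSupport ∨ (c, b) ∉ strictSupport := by
    revert a b; decide
  · exact hL.pivot (a, b) hpivot
  · refine block_mul_eq_zero_of_det_borderedMatrix (hminor a b) (hV.det_bordered (a, b) hbullet)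
      (fun y hy => hL.block_mul_eq_add_sum hV (hV.block_six_seven hminor) hbullet hy)
      fun p hp hap hpb => hL.pivot (a, p.2) ?_
    revert a b p; decide
  · exact hL.hasBlockSupport.block_mul_eq_zero hV.hasBlockSupport hlower

/-- The places above the diagonal where the normal form reached by reduction may have nonzero
blocks. -/
def reducedSupport : Finset (Fin 8 × Fin 8) := {(1, 2), (5, 6), (1, 5), (3, 4), (0, 7)}

theorem hasBlockSupport_normalForm_zero_zero_sub_one (α β p : ℝ) (B : Matrix (Fin k) (Fin k) ℝ)
    (D : Matrix (Fin m) (Fin m) ℝ) :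
    HasBlockSupport reducedSupport ((normalForm α β p 0 0 B D).1 - 1) := by
  intro a b h
  by_cases h' : (a, b) ∈ normalSupport
  · obtain ⟨rfl, rfl⟩ | ⟨rfl, rfl⟩ : (a = 1 ∧ b = 6) ∨ (a = 2 ∧ b = 6) := by
      revert a b; decide
    all_goals
      rw [block_sub_one_of_ne _ (by decide), normalForm, block_unipotent_of_lt _ (by decide)]
      rfl
  · exact hasBlockSupport_normalForm_sub_one α β p 0 0 B D a b h'

theorem IsReducing.mul_eq_mul (hL : IsReducing V L) (hV : VanishingConditions γ₁ γ₂ V)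
    (hminor : ∀ a b, (minorMatrix a b V).det ≠ 0) {N : PartitionedMatrix m k}
    (hN : HasBlockSupport reducedSupport N) (hPhi : ∀ p ∈ Phi, block p.1 p.2 N = block p.1 p.2 V)
    (h₁₅ : block 1 5 N = block 1 5 (L.1 * V) - block 1 2 V * block 2 5 L.1)
    (h₀₇ : block 0 7 N = block 0 7 (L.1 * V)) : L.1 * V = N * L.1 := by
  have hS := hL.hasBlockSupport
  refine block_ext fun a b => ?_
  obtain ⟨rfl, rfl⟩ | ⟨rfl, rfl⟩ | ⟨p, hp, rfl, hb, hpb⟩ | ⟨hN', h⟩ :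
      (a = 0 ∧ b = 7) ∨ (a = 1 ∧ b = 5) ∨
      (∃ p ∈ Phi, p.1 = a ∧ p.2 ≤ b ∧ (p.1, b) ≠ (1, 5)) ∨
      (∀ c, (a, c) ∉ reducedSupport ∨ (c, b) ∉ reductionSupport) ∧
        ((a ∈ ({0, 2, 4, 6} : Finset (Fin 8)) ∧ (a, b) ≠ (0, 7)) ∨
          ∀ c, (a, c) ∉ reductionSupport ∨ (c, b) ∉ strictSupport) := by
    revert a b; decide
  · rw [hN.block_mul_eq_mul hS 7 (by decide), hL.block_self, Matrix.mul_one, h₀₇]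
  · rw [hN.block_mul_eq_add hS 2 5 (by decide) (by decide), hL.block_self, Matrix.mul_one, h₁₅,
      hPhi (1, 2) (by decide), add_sub_cancel]
  · rw [hN.block_mul_eq_mul hS p.2 (by revert p b; decide), hPhi p hp]
    obtain rfl | hb := hb.eq_or_lt
    · rw [hS.block_mul_eq_mul hV.hasBlockSupport p.1 (by revert p; decide), hL.block_self,
        hL.block_self, Matrix.one_mul, Matrix.mul_one]
    · exact hL.block_mul p hp b hb hpb
  · rw [hN.block_mul_eq_zero hS hN']
    obtain ⟨ha, hab⟩ | h := h
    · exact hL.block_mul_eq_zero hV hminor ha hab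
    · exact hS.block_mul_eq_zero hV.hasBlockSupport h

/-- The normal forms of the elements of `Ann I'`. -/
def genericNormalForms (m k : ℕ) (γ₁ γ₂ : ℝ) : Set (UT (matSize m k)) :=
  {N | ∃ (α β p q r : ℝ) (B : Matrix (Fin k) (Fin k) ℝ) (D : Matrix (Fin m) (Fin m) ℝ),
    γ₁ * α = γ₂ * β ∧ α ≠ 0 ∧ β ≠ 0 ∧ B.det ≠ 0 ∧ N = normalForm α β p q r B D}

theorem of_default_default {ι κ R : Type*} [Unique ι] [Unique κ] (X : Matrix ι κ R) :
    Matrix.of (fun _ _ => X default default) = X :=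
  Matrix.ext fun i j => congrArg₂ X (Unique.default_eq i) (Unique.default_eq j)

theorem VanishingConditions.mem_conjugates {g : UT (matSize m k)}
    (hV : VanishingConditions γ₁ γ₂ (g.1 - 1)) : g ∈ conjugates (genericNormalForms m k γ₁ γ₂) := by
  obtain ⟨L, hL⟩ := hV.exists_isReducing
  set V := g.1 - 1 with hVg
  let P : Block m k 1 5 := block 1 5 (L.1 * V) - block 1 2 V * block 2 5 L.1
  let N : UT (matSize m k) := normalForm (block 1 2 V default default)
    (block 5 6 V default default) (P default default) 0 0 (block 3 4 V) (block 0 7 (L.1 * V))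
  have hblock {a b} (hab : a < b) := (block_sub_one_of_ne N.1 hab.ne).trans
    (block_unipotent_of_lt _ hab)
  have hmul : L.1 * V = (N.1 - 1) * L.1 := by
    refine hL.mul_eq_mul hV hV.det_minorMatrix_ne_zero
      (hasBlockSupport_normalForm_zero_zero_sub_one _ _ _ _ _) ?_ ?_ (hblock (by decide))
    · simp only [Phi, Finset.mem_insert, Finset.mem_singleton]
      rintro _ (rfl | rfl | rfl)
      exacts [(hblock (by decide)).trans (of_default_default _), hblock (by decide),
        (hblock (by decide)).trans (of_default_default _)]
    · exact (hblock (by decide)).trans (of_default_default P)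
  have hLg : L * g = N * L := Subtype.ext <| by
    rw [hVg] at hmul
    simpa [mul_sub, sub_mul] using hmul
  refine ⟨L⁻¹, N, ⟨_, _, _, 0, 0, _, _, hV.scalar, hV.one_two_ne_zero, hV.five_six_ne_zero,
    hV.det_three_four_ne_zero, rfl⟩, ?_⟩
  rw [inv_inv, mul_assoc, ← hLg, inv_mul_cancel_left]

end Reduction

/-! ### Conjugates of the normal form -/

section Conjugation

variable {m k : ℕ} {P : PartitionedMatrix m k} {a b : Fin 8}

theorem block_coe_mul (g : UT (matSize m k)) (hP : ∀ c, a < c → block c b P = 0) :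
    block a b (g.1 * P) = block a a g.1 * block a b P := by
  rw [block_mul]
  refine Finset.sum_eq_single_of_mem a (Finset.mem_univ a) fun c _ hca => ?_
  rcases hca.lt_or_gt with h | h
  · rw [block_eq_zero_of_lt g h, Matrix.zero_mul]
  · rw [hP c h, Matrix.mul_zero]

theorem block_mul_coe (g : UT (matSize m k)) (hP : ∀ d, d < b → block a d P = 0) :
    block a b (P * g.1) = block a b P * block b b g.1 := by
  rw [block_mul]
  refine Finset.sum_eq_single_of_mem b (Finset.mem_univ b) fun d _ hdb => ?_
  rcases hdb.lt_or_gt with h | h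
  · rw [hP d h, Matrix.zero_mul]
  · rw [block_eq_zero_of_lt g h, Matrix.mul_zero]

theorem block_coe_mul_eq_zero (g : UT (matSize m k)) (hP : ∀ c, a ≤ c → block c b P = 0) :
    block a b (g.1 * P) = 0 := by
  rw [block_coe_mul g fun c hc => hP c hc.le, hP a le_rfl, Matrix.mul_zero]

theorem block_mul_coe_eq_zero (g : UT (matSize m k)) (hP : ∀ d, d ≤ b → block a d P = 0) :
    block a b (P * g.1) = 0 := by
  rw [block_mul_coe g fun d hd => hP d hd.le, hP b le_rfl, Matrix.zero_mul]

theorem block_coe_mul_coe (g h : UT (matSize m k))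
    (hP : ∀ c d, a ≤ c → d ≤ b → (c, d) ≠ (a, b) → block c d P = 0) :
    block a b (g.1 * P * h.1) = block a a g.1 * block a b P * block b b h.1 := by
  rw [block_mul_coe h fun d hd => block_coe_mul_eq_zero g fun c hc =>
      hP c d hc hd.le fun h => hd.ne (congrArg Prod.snd h),
    block_coe_mul g fun c hc => hP c b hc.le le_rfl fun h => hc.ne' (congrArg Prod.fst h)]

theorem block_coe_mul_coe_eq_zero (g h : UT (matSize m k))
    (hP : ∀ c d, a ≤ c → d ≤ b → block c d P = 0) : block a b (g.1 * P * h.1) = 0 :=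
  block_mul_coe_eq_zero h fun d hd => block_coe_mul_eq_zero g fun c hc => hP c d hc hd

theorem det_mul_eq_zero_of_card_lt {K ι κ : Type*} [Field K] [Fintype ι] [Fintype κ]
    [DecidableEq κ] (h : Fintype.card ι < Fintype.card κ) (Y : Matrix κ ι K) (Z : Matrix ι κ K) :
    (Y * Z).det = 0 := by
  by_contra hdet
  have hrank := Matrix.rank_of_isUnit (Y * Z)
    ((Matrix.isUnit_iff_isUnit_det _).2 (isUnit_iff_ne_zero.2 hdet))
  exact h.not_ge (hrank ▸ (Matrix.rank_mul_le_left Y Z).trans (Matrix.rank_le_card_width Y))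

theorem det_mul_mul_ne_zero {n : ℕ} (g h : UT n) {B : Matrix (Fin n) (Fin n) ℝ}
    (hB : B.det ≠ 0) : (g.1 * B * h.1).det ≠ 0 := by
  rwa [Matrix.det_mul, Matrix.det_mul, UT.det_eq_one, UT.det_eq_one, one_mul, mul_one]

theorem minorRow_injective (a b : Fin 8) : Function.Injective (minorRow m k a b) := by
  have hPhi : ∀ p ∈ Phi, ∀ q ∈ Phi, p.1 = q.1 → p = q := by decide
  rintro ⟨⟨p, hp, hp'⟩, i⟩ ⟨⟨q, hq, hq'⟩, j⟩ h
  have h' := (pos_sigma_bijective m k).1 (a₁ := ⟨p.1, i⟩) (a₂ := ⟨q.1, j⟩) h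
  obtain rfl := hPhi p hp q hq (congrArg Sigma.fst h')
  obtain rfl : i = j := pos_inj.1 h
  rfl

theorem minorCol_injective (a b : Fin 8) : Function.Injective (minorCol m k a b) := by
  have hPhi : ∀ p ∈ Phi, ∀ q ∈ Phi, p.2 = q.2 → p = q := by decide
  rintro ⟨⟨p, hp, hp'⟩, i⟩ ⟨⟨q, hq, hq'⟩, j⟩ h
  have h' := (pos_sigma_bijective m k).1 (a₁ := ⟨p.2, _⟩) (a₂ := ⟨q.2, _⟩) h
  obtain rfl := hPhi p hp q hq (congrArg Sigma.fst h')
  obtain rfl : i = j := Fin.cast_injective _ (pos_inj.1 h)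
  rfl

theorem exists_borderedRow_eq (a b : Fin 8) (i : Fin (blockSize m k a))
    (x : Option (MinorIndex m k a b)) :
    ∃ c, a ≤ c ∧ ∃ s, x.elim (pos m k a i) (minorRow m k a b) = pos m k c s := by
  rcases x with _ | ⟨⟨p, hp, hap, hpb⟩, s⟩
  exacts [⟨a, le_rfl, i, rfl⟩, ⟨p.1, hap.le, s, rfl⟩]

theorem exists_borderedCol_eq (a b : Fin 8) (j : Fin (blockSize m k b))
    (y : Option (MinorIndex m k a b)) :
    ∃ d, d ≤ b ∧ ∃ t, y.elim (pos m k b j) (minorCol m k a b) = pos m k d t := by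
  rcases y with _ | ⟨⟨p, hp, hap, hpb⟩, t⟩
  exacts [⟨b, le_rfl, j, rfl⟩, ⟨p.2, hpb.le, _, rfl⟩]

theorem det_borderedMatrix_mul_eq_zero {Y Z : PartitionedMatrix m k}
    {e : MinorIndex m k a b → Fin (matSize m k)} (he : Function.Injective e)
    (h : ∀ c, (∀ s, pos m k c s ∈ Set.range e) ∨ (∀ a', a ≤ a' → block a' c Y = 0) ∨
      ∀ b', b' ≤ b → block c b' Z = 0)
    (i : Fin (blockSize m k a)) (j : Fin (blockSize m k b)) :
    (borderedMatrix a b i j (Y * Z)).det = 0 := by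
  suffices hmul : borderedMatrix a b i j (Y * Z) =
      Y.submatrix (fun x => x.elim (pos m k a i) (minorRow m k a b)) e *
        Z.submatrix e (fun y => y.elim (pos m k b j) (minorCol m k a b)) by
    rw [hmul]
    exact det_mul_eq_zero_of_card_lt (by simp) _ _
  ext x y
  refine (Finset.sum_of_injOn e he.injOn (fun _ _ => Finset.mem_coe.2 (Finset.mem_univ _))
    (fun u _ hu => ?_) fun _ _ => rfl).symm
  obtain ⟨c, s, rfl⟩ := exists_pos_eq u
  obtain ⟨a', ha, i', hi⟩ := exists_borderedRow_eq a b i x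
  obtain ⟨b', hb, j', hj⟩ := exists_borderedCol_eq a b j y
  change Y (x.elim (pos m k a i) (minorRow m k a b)) _ *
    Z _ (y.elim (pos m k b j) (minorCol m k a b)) = 0
  rw [hi, hj]
  rcases h c with h | h | h
  · obtain ⟨x, hx⟩ := h s
    exact absurd ⟨x, Finset.mem_coe.2 (Finset.mem_univ x), hx⟩ hu
  · rw [show Y (pos m k a' i') (pos m k c s) = 0 from congrFun₂ (h a' ha) i' s, zero_mul]
  · rw [show Z (pos m k c s) (pos m k b' j') = 0 from congrFun₂ (h b' hb) s j', mul_zero]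

variable {S : Finset (Fin 8 × Fin 8)}

theorem HasBlockSupport.det_borderedMatrix_conj_of_rows (hP : HasBlockSupport S P)
    (h : ∀ c d, a ≤ c → d ≤ b → (c, d) ∈ S → ∃ p ∈ Phi, a < p.1 ∧ p.2 < b ∧ p.1 = c)
    (g g' : UT (matSize m k)) (i : Fin (blockSize m k a)) (j : Fin (blockSize m k b)) :
    (borderedMatrix a b i j (g.1 * P * g'.1)).det = 0 := by
  rw [Matrix.mul_assoc]
  refine det_borderedMatrix_mul_eq_zero (minorRow_injective a b) (fun c => ?_) i j
  rcases lt_or_ge c a with hca | hac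
  · exact .inr (.inl fun a' ha => block_eq_zero_of_lt g (hca.trans_le ha))
  by_cases hc : ∃ p ∈ Phi, a < p.1 ∧ p.2 < b ∧ p.1 = c
  · obtain ⟨p, hp, hap, hpb, rfl⟩ := hc
    exact .inl fun s => ⟨⟨⟨p, hp, hap, hpb⟩, s⟩, rfl⟩
  · exact .inr (.inr fun b' hb => block_mul_coe_eq_zero g' fun d hd =>
      hP c d fun hcd => hc (h c d hac (hd.trans hb) hcd))

theorem HasBlockSupport.det_borderedMatrix_conj_of_cols (hP : HasBlockSupport S P)
    (h : ∀ c d, a ≤ c → d ≤ b → (c, d) ∈ S → ∃ p ∈ Phi, a < p.1 ∧ p.2 < b ∧ p.2 = d)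
    (g g' : UT (matSize m k)) (i : Fin (blockSize m k a)) (j : Fin (blockSize m k b)) :
    (borderedMatrix a b i j (g.1 * P * g'.1)).det = 0 := by
  refine det_borderedMatrix_mul_eq_zero (minorCol_injective a b) (fun d => ?_) i j
  rcases lt_or_ge b d with hbd | hdb
  · exact .inr (.inr fun b' hb => block_eq_zero_of_lt g' (hb.trans_lt hbd))
  by_cases hd : ∃ p ∈ Phi, a < p.1 ∧ p.2 < b ∧ p.2 = d
  · obtain ⟨p, hp, hap, hpb, rfl⟩ := hd
    exact .inl fun t => ⟨⟨⟨p, hp, hap, hpb⟩, Fin.cast (blockSize_of_mem_Phi m k hp).symm t⟩, rfl⟩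
  · exact .inr (.inl fun a' ha => block_coe_mul_eq_zero g fun c hc =>
      hP c d fun hcd => hd (h c d (ha.trans hc) hdb hcd))

theorem HasBlockSupport.det_borderedMatrix_conj_eq_zero (hP : HasBlockSupport normalSupport P)
    (g g' : UT (matSize m k)) {p : Fin 8 × Fin 8} (hp : p ∈ bulletBlocks) (i j) :
    (borderedMatrix p.1 p.2 i j (g.1 * P * g'.1)).det = 0 := by
  by_cases hp' : p = (2, 7)
  · subst hp'
    exact hP.det_borderedMatrix_conj_of_cols (by decide) g g' i j
  · refine hP.det_borderedMatrix_conj_of_rows ?_ g g' i j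
    clear i j
    simp only [bulletBlocks, Finset.mem_insert, Finset.mem_singleton] at hp
    rcases hp with rfl | rfl | rfl | rfl | rfl | rfl | rfl | rfl | rfl <;>
      first | exact absurd rfl hp' | decide

theorem HasBlockSupport.vanishingConditions_conj {γ₁ γ₂ : ℝ} (hP : HasBlockSupport normalSupport P)
    (h₁₂ : block 1 2 P default default ≠ 0) (h₃₄ : Matrix.det (n := Fin k) (block 3 4 P) ≠ 0)
    (h₅₆ : block 5 6 P default default ≠ 0)
    (hγ : γ₁ * block 1 2 P default default = γ₂ * block 5 6 P default default)
    (h : UT (matSize m k)) : VanishingConditions γ₁ γ₂ (h.1 * P * (h⁻¹).1) := by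
  have hblock {a b} (hab : ∀ c d, a ≤ c → d ≤ b → (c, d) ≠ (a, b) → (c, d) ∉ normalSupport) :
      block a b (h.1 * P * (h⁻¹).1) = block a a h.1 * block a b P * block b b (h⁻¹).1 :=
    block_coe_mul_coe h h⁻¹ fun c d hc hd hcd => hP c d (hab c d hc hd hcd)
  have hconj₁₂ : block 1 2 (h.1 * P * (h⁻¹).1) = block 1 2 P := by
    rw [hblock (by decide), block_self_eq_one, block_self_eq_one, Matrix.one_mul, Matrix.mul_one]
  have hconj₅₆ : block 5 6 (h.1 * P * (h⁻¹).1) = block 5 6 P := by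
    rw [hblock (by decide), block_self_eq_one, block_self_eq_one, Matrix.one_mul, Matrix.mul_one]
  have hsq : h.1 * P * (h⁻¹).1 * (h.1 * P * (h⁻¹).1) = h.1 * (P * P) * (h⁻¹).1 := by
    rw [Matrix.mul_assoc (h.1 * P), ← Matrix.mul_assoc (h⁻¹).1, ← Matrix.mul_assoc (h⁻¹).1,
      UT.coe_inv_mul_coe, Matrix.one_mul]
    simp only [Matrix.mul_assoc]
  have hsq_eq_zero {a b} (hab : ∀ c d, a ≤ c → d ≤ b →
      ∀ e, (c, e) ∉ normalSupport ∨ (e, d) ∉ normalSupport) :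
      block a b (h.1 * P * (h⁻¹).1 * (h.1 * P * (h⁻¹).1)) = 0 := by
    rw [hsq]
    exact block_coe_mul_coe_eq_zero h h⁻¹ fun c d hc hd => hP.block_mul_eq_zero hP (hab c d hc hd)
  refine
    { hasBlockSupport := fun a b hab => block_coe_mul_coe_eq_zero h h⁻¹ fun c d hc hd => hP c d ?_
      one_two_ne_zero := by rwa [hconj₁₂]
      det_three_four_ne_zero := ?_
      five_six_ne_zero := by rwa [hconj₅₆]
      det_bordered := fun p hp i j => hP.det_borderedMatrix_conj_eq_zero h h⁻¹ hp i j
      sq_one_four := hsq_eq_zero (by decide)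
      sq_three_six := hsq_eq_zero (by decide)
      scalar := by rwa [hconj₁₂, hconj₅₆] }
  · have hdiag : ∀ c d : Fin 8, d ≤ c → (c, d) ∉ normalSupport := by decide
    have hba : b ≤ a := by simpa [strictSupport] using hab
    exact hdiag c d (hd.trans (hba.trans hc))
  · rw [hblock (by decide)]
    exact det_mul_mul_ne_zero ⟨_, block_self_mem_UT h 3⟩ ⟨_, block_self_mem_UT h⁻¹ 4⟩ h₃₄

theorem zeroSet_idealI'_eq_conjugates (m k : ℕ) (γ₁ γ₂ : ℝ) :
    zeroSet m k (idealI' m k γ₁ γ₂) = conjugates (genericNormalForms m k γ₁ γ₂) := by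
  ext g
  rw [mem_zeroSet_idealI'_iff]
  refine ⟨VanishingConditions.mem_conjugates, ?_⟩
  rintro ⟨h, _, ⟨α, β, p, q, r, B, D, hαβ, hα, hβ, hB, rfl⟩, rfl⟩
  have hconj : (h * normalForm α β p q r B D * h⁻¹).1 - 1 =
      h.1 * ((normalForm α β p q r B D).1 - 1) * (h⁻¹).1 := by
    rw [Matrix.mul_sub, Matrix.sub_mul, Matrix.mul_one, UT.coe_mul_coe_inv]
    rfl
  have hblock {a b} (hab : a ≠ b) := block_sub_one_of_ne (normalForm α β p q r B D).1 hab
  rw [hconj]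
  refine (hasBlockSupport_normalForm_sub_one α β p q r B D).vanishingConditions_conj ?_ ?_ ?_ ?_ h
  · rwa [hblock (by decide), block_normalForm_one_two]
  · rwa [hblock (by decide), block_normalForm_three_four]
  · rwa [hblock (by decide), block_normalForm_five_six]
  · rwa [hblock (by decide), block_normalForm_one_two, hblock (by decide),
      block_normalForm_five_six]

end Conjugation

/-! ### Closures -/

section Closure

variable {m k : ℕ}

/-- The block diagonal element of the group with the diagonal blocks `U a`. -/
noncomputable def diagonalElement (U : ∀ a, UT (blockSize m k a)) : UT (matSize m k) :=
  ⟨ofBlocks m k fun a b => if h : a = b then h ▸ (U a).1 else 0, mem_UT_of_block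
    (fun a => by
      rw [block_ofBlocks, dif_pos rfl]
      exact (U a).2)
    (fun a b h => by rw [block_ofBlocks, dif_neg h.ne'])⟩

theorem block_diagonalElement_self (U : ∀ a, UT (blockSize m k a)) (a : Fin 8) :
    block a a (diagonalElement U).1 = (U a).1 := by
  rw [diagonalElement, block_ofBlocks, dif_pos rfl]

theorem block_diagonalElement_of_ne (U : ∀ a, UT (blockSize m k a)) {a b : Fin 8} (h : a ≠ b) :
    block a b (diagonalElement U).1 = 0 := by
  rw [diagonalElement, block_ofBlocks, dif_neg h]

theorem block_diagonalElement_mul (U : ∀ a, UT (blockSize m k a)) (P : PartitionedMatrix m k)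
    (a b : Fin 8) : block a b ((diagonalElement U).1 * P) = (U a).1 * block a b P := by
  rw [block_mul, Finset.sum_eq_single_of_mem a (Finset.mem_univ a) fun c _ hc => by
    rw [block_diagonalElement_of_ne U hc.symm, Matrix.zero_mul], block_diagonalElement_self]

theorem block_mul_diagonalElement (U : ∀ a, UT (blockSize m k a)) (P : PartitionedMatrix m k)
    (a b : Fin 8) : block a b (P * (diagonalElement U).1) = block a b P * (U b).1 := by
  rw [block_mul, Finset.sum_eq_single_of_mem b (Finset.mem_univ b) fun c _ hc => by
    rw [block_diagonalElement_of_ne U hc, Matrix.mul_zero], block_diagonalElement_self]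

/-- Diagonal blocks acting on the blocks `B` and `D` of a normal form only. -/
def normalizingBlocks (U₀ : UT m) (U₃ U₄ : UT k) (U₇ : UT m) (a : Fin 8) : UT (blockSize m k a) :=
  match a with
  | 0 => U₀
  | 3 => U₃
  | 4 => U₄
  | 7 => U₇
  | _ => 1

theorem diagonalElement_mul_normalForm (U₀ V₇ : UT m) (U₃ V₄ : UT k) (α β p q r : ℝ)
    (B : Matrix (Fin k) (Fin k) ℝ) (D : Matrix (Fin m) (Fin m) ℝ) :
    diagonalElement (normalizingBlocks U₀ U₃ V₄⁻¹ V₇⁻¹) * normalForm α β p q r B D =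
      normalForm α β p q r (U₃.1 * B * V₄.1) (U₀.1 * D * V₇.1) *
        diagonalElement (normalizingBlocks U₀ U₃ V₄⁻¹ V₇⁻¹) := by
  set H := diagonalElement (normalizingBlocks U₀ U₃ V₄⁻¹ V₇⁻¹)
  set N := normalForm α β p q r B D
  set N' := normalForm α β p q r (U₃.1 * B * V₄.1) (U₀.1 * D * V₇.1)
  suffices hmul : H.1 * (N.1 - 1) = (N'.1 - 1) * H.1 from
    Subtype.ext <| by simpa [mul_sub, sub_mul] using hmul
  refine block_ext fun a b => ?_
  rw [block_diagonalElement_mul, block_mul_diagonalElement, block_normalForm_sub_one,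
    block_normalForm_sub_one]
  by_cases hS : (a, b) ∈ normalSupport
  · have hV₄ : U₃.1 * B * V₄.1 * (V₄⁻¹).1 = U₃.1 * B := by
      rw [Matrix.mul_assoc, UT.coe_mul_coe_inv, Matrix.mul_one]
    have hV₇ : U₀.1 * D * V₇.1 * (V₇⁻¹).1 = U₀.1 * D := by
      rw [Matrix.mul_assoc, UT.coe_mul_coe_inv, Matrix.mul_one]
    simp only [normalSupport, Finset.mem_insert, Finset.mem_singleton, Prod.mk.injEq] at hS
    rcases hS with ⟨rfl, rfl⟩ | ⟨rfl, rfl⟩ | ⟨rfl, rfl⟩ | ⟨rfl, rfl⟩ | ⟨rfl, rfl⟩ | ⟨rfl, rfl⟩ |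
      ⟨rfl, rfl⟩
    case inr.inr.inr.inr.inr.inl => exact hV₄.symm
    case inr.inr.inr.inr.inr.inr => exact hV₇.symm
    all_goals exact (Matrix.one_mul _).trans (Matrix.mul_one _).symm
  · rw [normalBlocks_eq_zero _ _ _ _ _ _ _ hS, normalBlocks_eq_zero _ _ _ _ _ _ _ hS,
      Matrix.mul_zero, Matrix.zero_mul]

theorem subset_conjugates {n : ℕ} (S : Set (UT n)) : S ⊆ conjugates S :=
  fun x hx => ⟨1, x, hx, by group⟩

theorem conj_mem_conjugates {n : ℕ} {S : Set (UT n)} (h : UT n) {x : UT n}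
    (hx : x ∈ conjugates S) : h * x * h⁻¹ ∈ conjugates S := by
  obtain ⟨h', y, hy, rfl⟩ := hx
  exact ⟨h * h', y, hy, by group⟩

theorem conjugates_subset_closure_conjugates {n : ℕ} {S T : Set (UT n)}
    (h : S ⊆ closure (conjugates T)) : conjugates S ⊆ closure (conjugates T) := by
  rintro _ ⟨g, y, hy, rfl⟩
  have hf : Continuous fun x : UT n => g * x * g⁻¹ := by fun_prop
  exact map_mem_closure (f := fun x => g * x * g⁻¹) hf (h hy) fun x hx => conj_mem_conjugates g hx

variable {l₁ : Fin m → ℝ} {l₂ : Fin k → ℝ} {γ₁ γ₂ γ₃ : ℝ}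

theorem genericNormalForms_subset_closure :
    genericNormalForms m k γ₁ γ₂ ⊆
      closure (conjugates (coadjStabilizer (traceDual (fMatrix m k l₁ l₂ γ₁ γ₂ γ₃)))) := by
  rintro _ ⟨α, β, p, q, r, B, D, hαβ, -, -, -, rfl⟩
  have hf : Continuous (Function.uncurry fun (B : Matrix (Fin k) (Fin k) ℝ)
      (D : Matrix (Fin m) (Fin m) ℝ) => normalForm α β p q r B D) :=
    continuous_normalForm continuous_const continuous_const continuous_const continuous_const
      continuous_const continuous_fst continuous_snd
  refine map_mem_closure₂ hf (dense_bigCell k B) (dense_bigCell m D) ?_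
  rintro _ ⟨U₃, V₄, b, rfl⟩ _ ⟨U₀, V₇, d, rfl⟩
  exact ⟨_, _, normalForm_mem_coadjStabilizer hαβ p q r b d,
    eq_mul_inv_of_mul_eq (diagonalElement_mul_normalForm U₀ V₇ U₃ V₄ α β p q r _ _).symm⟩

theorem coadjStabilizer_fMatrix_subset_closure (hl₁ : ∀ j, l₁ j ≠ 0)
    (hl₂ : ∀ j : Fin k, (j : ℕ) + 1 < k → l₂ j ≠ 0) (hγ₁ : γ₁ ≠ 0) (hγ₂ : γ₂ ≠ 0) :
    coadjStabilizer (traceDual (fMatrix m k l₁ l₂ γ₁ γ₂ γ₃)) ⊆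
      closure (genericNormalForms m k γ₁ γ₂) := by
  intro g hg
  obtain ⟨α, β, p, q, r, b, d, hαβ, rfl⟩ :=
    exists_eq_normalForm_of_mem_coadjStabilizer hl₁ hl₂ hγ₁ hγ₂ hg
  obtain ⟨t, rfl⟩ : ∃ t, α = γ₂ * t := ⟨α / γ₂, (mul_div_cancel₀ α hγ₂).symm⟩
  obtain rfl : γ₁ * t = β := mul_left_cancel₀ hγ₂ (by rw [← hαβ, mul_left_comm])
  let f (t : ℝ) (b : Fin k → ℝ) : UT (matSize m k) :=
    normalForm (γ₂ * t) (γ₁ * t) p q r (antidiag b) (antidiag d)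
  have hf : Continuous (Function.uncurry f) :=
    continuous_normalForm (continuous_const.mul continuous_fst)
      (continuous_const.mul continuous_fst) continuous_const continuous_const continuous_const
      (continuous_antidiag.comp continuous_snd) continuous_const
  have hb := dense_pi (Set.univ : Set (Fin k)) (fun _ _ => dense_compl_singleton (0 : ℝ)) b
  refine map_mem_closure₂ (f := f) hf (dense_compl_singleton 0 t) hb fun t' ht b' hb' => ?_
  exact ⟨_, _, p, q, r, _, _, mul_left_comm _ _ _, mul_ne_zero hγ₂ ht, mul_ne_zero hγ₁ ht,
    det_antidiag_ne_zero fun j => hb' j trivial, rfl⟩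

end Closure

/-- `UT (matSize m k)` carries the topology of real matrices (subspace topology). -/
theorem proposition5 (m k : ℕ) (l₁ : Fin m → ℝ) (l₂ : Fin k → ℝ) (γ₁ γ₂ γ₃ : ℝ)
    (hl₁ : ∀ j, l₁ j ≠ 0) (hl₂ : ∀ j : Fin k, (j : ℕ) + 1 < k → l₂ j ≠ 0)
    (hγ₁ : γ₁ ≠ 0) (hγ₂ : γ₂ ≠ 0) :
    closure (zeroSet m k (idealI' m k γ₁ γ₂)) =
      closure (conjugates (coadjStabilizer (traceDual (fMatrix m k l₁ l₂ γ₁ γ₂ γ₃)))) := by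
  rw [zeroSet_idealI'_eq_conjugates]
  exact Set.Subset.antisymm
    (closure_minimal (conjugates_subset_closure_conjugates
      genericNormalForms_subset_closure) isClosed_closure)
    (closure_minimal (conjugates_subset_closure_conjugates
      ((coadjStabilizer_fMatrix_subset_closure hl₁ hl₂ hγ₁ hγ₂).trans
        (closure_mono (subset_conjugates _)))) isClosed_closure)
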